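/- Let $\chi(\mathbb E^n)$ be the least number of colors needed to color the Euclidean space $\mathbb E^n$ so that any two points at distance one receive different colors. Then $$\chi(\mathbb E^5)\le 140,\qquad \chi(\mathbb E^7)\le 1372,\qquad \chi(\mathbb E^9)\le 17253 .$$ Moreover, the following sublattice colorings exist. For a lattice $\Lambda$ with linear span $X$, let $V=\{x\in X: |x|\le|x-z|\ \forall z\in\Lambda\}$ be its Voronoi cell, $\operatorname{int}V$ its interior relative to $X$, and $R$ its covering radius (the least $R$ such that the closed balls of radius $R$ centred at the points of $\Lambda$ cover $X$). For a sublattice $\Lambda'\subset\Lambda$ let $c(\Lambda,\Lambda')$ be the coloring in which each point of $v+\operatorname{int}V$, $v\in\Lambda$, is colored by the class of $v$ in $\Lambda/\Lambda'$. For $n\in\{5,9\}$ let $M_n$ be the $(n+1)\times n$ matrix with diagonal entries $-n$ and all other entries $1$, and let $$M_7=\begin{pmatrix}-1&0&0&0&0&0&-\frac34\\1&-1&0&0&0&0&-\frac34\\0&1&-1&0&0&0&\frac14\\0&0&1&-1&0&0&\frac14\\0&0&0&1&-1&0&\frac14\\0&0&0&0&1&-1&\frac14\\0&0&0&0&0&1&\frac14\\0&0&0&0&0&0&\frac14\end{pmatrix}.$$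 Then $M_5\mathbb Z^5=6A_5^*$, $M_7\mathbb Z^7=E_7^*$ and $M_9\mathbb Z^9=10A_9^*$, where $L^*$ is the dual of the lattice $L$ in its span, $A_n=\{x\in\mathbb Z^{n+1}:\sum_i x_i=0\}$ and $E_7=\{x\in\mathbb Z^8\cup(\mathbb Z+\frac12)^8:\sum_i x_i=0\}$. Let $$C_5=\begin{pmatrix}-2&1&-2&-1&0\\-3&1&0&-1&-2\\0&1&1&-1&-3\\-2&0&-2&2&-2\\-2&-2&0&0&-2\end{pmatrix},\quad C_7=\begin{pmatrix}0&-4&-5&-3&-4&-4&-1\\-1&-5&-10&-7&-5&-5&-4\\-2&-2&-9&-4&-5&-4&-4\\-3&-2&-5&-4&-4&-1&-3\\-1&-1&-4&-1&-3&0&-3\\-2&0&-1&0&0&0&0\\0&4&6&4&4&4&4\end{pmatrix},$$ $$C_9=\begin{pmatrix}0&0&-3&1&0&0&-1&1&0\\1&0&-3&1&1&0&-1&4&1\\0&0&-2&1&0&-1&-1&1&3\\0&0&-3&4&0&0&-1&1&0\\0&3&-3&1&0&0&-1&1&0\\3&0&-3&1&0&0&2&1&0\\0&0&-4&2&0&3&-1&2&0\\0&0&-3&1&3&0&-1&1&0\\-1&0&-3&1&-1&1&1&1&-1\end{pmatrix}.$$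 For each $n\in\{5,7,9\}$, with $\Lambda=M_n\mathbb Z^n$ and $\Lambda'=M_nC_n\mathbb Z^n$: the lattice $\Lambda$ has rank $n$; $\Lambda'$ is a sublattice of $\Lambda$ of index $140$, $1372$, $17253$ respectively; $\operatorname{dist}(V,v+V)\ge 2R$ for every $v\in\Lambda'\setminus\{0\}$; and no two points of the same color in $c(\Lambda,\Lambda')$ are at distance $2R$. -/

import Mathlib

open scoped Pointwise

/-- The unit distance graph of a metric space: two points are adjacent when they are at
distance exactly one. -/
def unitDistanceGraph (E : Type*) [MetricSpace E] : SimpleGraph E where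
  Adj x y := dist x y = 1
  symm := ⟨fun x y h => by rw [dist_comm]; exact h⟩
  loopless := ⟨fun x h => by simp at h⟩

/-- The chromatic number `χ(𝔼ⁿ)` of the Euclidean space of dimension `n`. -/
noncomputable def chiEuclidean (n : ℕ) : ℕ∞ :=
  (unitDistanceGraph (EuclideanSpace ℝ (Fin n))).chromaticNumber

section Lattices

/-- The set `M ℤⁿ` generated by a real `m × n` matrix `M`, as an additive subgroup of `𝔼ᵐ`. -/
def matrixLattice {m n : ℕ} (M : Matrix (Fin m) (Fin n) ℝ) :
    AddSubgroup (EuclideanSpace ℝ (Fin m)) where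
  carrier := {x | ∃ k : Fin n → ℤ, x = WithLp.toLp 2 (M.mulVec fun j => (k j : ℝ))}
  zero_mem' := ⟨0, by ext i; simp [Matrix.mulVec, dotProduct]⟩
  add_mem' := by
    rintro _ _ ⟨k, rfl⟩ ⟨l, rfl⟩
    exact ⟨k + l, by
      ext i
      simp [Matrix.mulVec, dotProduct, mul_add, Finset.sum_add_distrib]⟩
  neg_mem' := by
    rintro _ ⟨k, rfl⟩
    exact ⟨-k, by ext i; simp [Matrix.mulVec, dotProduct]⟩

variable {E : Type*} [NormedAddCommGroup E] [InnerProductSpace ℝ E]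

/-- The subspace `X` spanned by a lattice; the lattice is full rank in `X`. -/
def latticeSpan (L : AddSubgroup E) : Submodule ℝ E := Submodule.span ℝ (L : Set E)

/-- The dual lattice `L*`, inside the subspace spanned by `L`. -/
def dualLattice (L : AddSubgroup E) : AddSubgroup E where
  carrier := {x | x ∈ latticeSpan L ∧ ∀ z ∈ L, ∃ k : ℤ, inner ℝ x z = (k : ℝ)}
  zero_mem' := ⟨Submodule.zero_mem _, fun z _ => ⟨0, by simp⟩⟩
  add_mem' := by
    rintro x y ⟨hx, hx'⟩ ⟨hy, hy'⟩
    refine ⟨Submodule.add_mem _ hx hy, fun z hz => ?_⟩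
    obtain ⟨k, hk⟩ := hx' z hz
    obtain ⟨l, hl⟩ := hy' z hz
    exact ⟨k + l, by rw [inner_add_left, hk, hl]; push_cast; rfl⟩
  neg_mem' := by
    rintro x ⟨hx, hx'⟩
    refine ⟨Submodule.neg_mem _ hx, fun z hz => ?_⟩
    obtain ⟨k, hk⟩ := hx' z hz
    exact ⟨-k, by rw [inner_neg_left, hk]; push_cast; rfl⟩

/-- The Voronoi cell of a lattice around the origin, inside the span of the lattice. -/
def voronoiCell (L : AddSubgroup E) : Set E :=
  {x | x ∈ latticeSpan L ∧ ∀ z ∈ L, ‖x‖ ≤ ‖x - z‖}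

/-- The interior of the Voronoi cell relative to the span of the lattice. -/
def voronoiInterior (L : AddSubgroup E) : Set E :=
  {x | x ∈ voronoiCell L ∧
    ∃ ε > 0, ∀ y ∈ latticeSpan L, dist y x < ε → y ∈ voronoiCell L}

/-- The covering radius of a lattice: the least `R` such that the closed balls of radius `R`
centred at the lattice points cover the span of the lattice. -/
noncomputable def coveringRadius (L : AddSubgroup E) : ℝ :=
  sInf {R : ℝ | ∀ x ∈ latticeSpan L, ∃ z ∈ L, dist x z ≤ R}

/-- The distance `inf {|x - y| : x ∈ A, y ∈ B}` between two sets (used for nonempty sets). -/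
noncomputable def setDist (A B : Set E) : ℝ :=
  sInf {d : ℝ | ∃ x ∈ A, ∃ y ∈ B, d = dist x y}

/-- In the sublattice coloring `c(L, L')` every point of `v + int V`, `v ∈ L`, is colored with the
class of `v` in `L / L'`. This says that no two points of the same color are at distance `ℓ`. -/
def SublatticeColoringAvoids (L L' : AddSubgroup E) (ℓ : ℝ) : Prop :=
  ∀ v ∈ L, ∀ w ∈ L, v - w ∈ L' →
    ∀ x ∈ voronoiInterior L, ∀ y ∈ voronoiInterior L, dist (v + x) (w + y) ≠ ℓ

/-- `L` has rank `n`, `L'` is a sublattice of `L` of index `N`, the Voronoi cells of `L` around `0`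
and around any nonzero vector of `L'` are at distance at least twice the covering radius `R`, and
the coloring `c(L, L')`, which has `N` colors, has no monochromatic pair at distance `2R`. -/
structure IsSublatticeColoringScheme (L L' : AddSubgroup E) (n N : ℕ) : Prop where
  rank_eq : Module.finrank ℝ (latticeSpan L) = n
  le : L' ≤ L
  index_eq : L'.relIndex L = N
  cell_dist : ∀ v ∈ L', v ≠ 0 →
    2 * coveringRadius L ≤ setDist (voronoiCell L) ((fun x => v + x) '' voronoiCell L)
  avoids : SublatticeColoringAvoids L L' (2 * coveringRadius L)

end Lattices

/-- The root lattice `A_n`: integer vectors of `𝔼ⁿ⁺¹` with coordinate sum zero. -/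
def rootLatticeA (n : ℕ) : AddSubgroup (EuclideanSpace ℝ (Fin (n + 1))) where
  carrier := {x | (∀ i, ∃ k : ℤ, x i = (k : ℝ)) ∧ ∑ i, x i = 0}
  zero_mem' := ⟨fun _ => ⟨0, by simp⟩, by simp⟩
  add_mem' := by
    rintro x y ⟨hx, hx'⟩ ⟨hy, hy'⟩
    refine ⟨fun i => ?_, by simp [Finset.sum_add_distrib, hx', hy']⟩
    obtain ⟨k, hk⟩ := hx i
    obtain ⟨l, hl⟩ := hy i
    exact ⟨k + l, by simp [hk, hl]⟩
  neg_mem' := by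
    rintro x ⟨hx, hx'⟩
    refine ⟨fun i => ?_, by simp [hx']⟩
    obtain ⟨k, hk⟩ := hx i
    exact ⟨-k, by simp [hk]⟩

/-- The root lattice `E_7`: the vectors of `E_8` with coordinate sum zero, that is, the vectors of
`𝔼⁸` with coordinate sum zero whose coordinates are all in `ℤ` or all in `ℤ + 1/2`. -/
def rootLatticeE7 : AddSubgroup (EuclideanSpace ℝ (Fin 8)) where
  carrier := {x | (∃ e : ℤ, ∀ i, ∃ k : ℤ, x i = (k : ℝ) + (e : ℝ) / 2) ∧ ∑ i, x i = 0}
  zero_mem' := ⟨⟨0, fun _ => ⟨0, by simp⟩⟩, by simp⟩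
  add_mem' := by
    rintro x y ⟨⟨e, hx⟩, hx'⟩ ⟨⟨f, hy⟩, hy'⟩
    refine ⟨⟨e + f, fun i => ?_⟩, by
      simp only [PiLp.add_apply, Finset.sum_add_distrib, hx', hy', add_zero]⟩
    obtain ⟨k, hk⟩ := hx i
    obtain ⟨l, hl⟩ := hy i
    exact ⟨k + l, by rw [PiLp.add_apply, hk, hl]; push_cast; ring⟩
  neg_mem' := by
    rintro x ⟨⟨e, hx⟩, hx'⟩
    refine ⟨⟨-e, fun i => ?_⟩, by simp only [PiLp.neg_apply, Finset.sum_neg_distrib, hx', neg_zero]⟩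
    obtain ⟨k, hk⟩ := hx i
    exact ⟨-k, by rw [PiLp.neg_apply, hk]; push_cast; ring⟩

/-- The `(n+1) × n` generator matrix of the dilation `(n+1) A_n*`: the entry is `-n` on the
diagonal and `1` elsewhere. -/
def genA (n : ℕ) : Matrix (Fin (n + 1)) (Fin n) ℝ :=
  Matrix.of fun i j => if i = j.castSucc then -(n : ℝ) else 1

/-- The generator matrix of `E_7*`. -/
noncomputable def genE7 : Matrix (Fin 8) (Fin 7) ℝ :=
  !![-1,  0,  0,  0,  0,  0, -3/4;
      1, -1,  0,  0,  0,  0, -3/4;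
      0,  1, -1,  0,  0,  0,  1/4;
      0,  0,  1, -1,  0,  0,  1/4;
      0,  0,  0,  1, -1,  0,  1/4;
      0,  0,  0,  0,  1, -1,  1/4;
      0,  0,  0,  0,  0,  1,  1/4;
      0,  0,  0,  0,  0,  0,  1/4]

/-- The matrix `C_5`. -/
def matC5 : Matrix (Fin 5) (Fin 5) ℤ :=
  !![-2,  1, -2, -1,  0;
     -3,  1,  0, -1, -2;
      0,  1,  1, -1, -3;
     -2,  0, -2,  2, -2;
     -2, -2,  0,  0, -2]

/-- The matrix `C_7`. -/
def matC7 : Matrix (Fin 7) (Fin 7) ℤ :=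
  !![ 0, -4,  -5, -3, -4, -4, -1;
     -1, -5, -10, -7, -5, -5, -4;
     -2, -2,  -9, -4, -5, -4, -4;
     -3, -2,  -5, -4, -4, -1, -3;
     -1, -1,  -4, -1, -3,  0, -3;
     -2,  0,  -1,  0,  0,  0,  0;
      0,  4,   6,  4,  4,  4,  4]

/-- The matrix `C_9`. -/
def matC9 : Matrix (Fin 9) (Fin 9) ℤ :=
  !![ 0, 0, -3, 1,  0,  0, -1, 1,  0;
      1, 0, -3, 1,  1,  0, -1, 4,  1;
      0, 0, -2, 1,  0, -1, -1, 1,  3;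
      0, 0, -3, 4,  0,  0, -1, 1,  0;
      0, 3, -3, 1,  0,  0, -1, 1,  0;
      3, 0, -3, 1,  0,  0,  2, 1,  0;
      0, 0, -4, 2,  0,  3, -1, 2,  0;
      0, 0, -3, 1,  3,  0, -1, 1,  0;
     -1, 0, -3, 1, -1,  1,  1, 1, -1]

/-! Let V be the Voronoi cell of Λ. Two equally colored points in one open cell are at distance less
than 2R, since int V lies in the open ball of radius R. If they lie in different cells, their
distance is at least that between V and v + V with v ∈ Λ' nonzero, hence at least 2R, and strictly
more because the cells are open (`sublatticeColoringAvoids_of_cell_dist`). Cell walls carry no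
color, so the bound on χ comes from compactness: each finite set of points can be translated off the
walls, and finite subgraphs suffice (`chiEuclidean_le_of_isSublatticeColoringScheme`).

It remains to bound dist(V, v + V) from below. By the triangle inequality only vectors v with |v| <
4r matter, where r is an upper bound for R. For these, a direction u = ∑ c z with c ≥ 0 and z ∈ Λ
separates the cells: every x ∈ V satisfies 2⟨x, z⟩ ≤ |z|², so the gap along u is at least ⟨v, u⟩ - ∑
c|z|², and Cauchy–Schwarz turns it into a distance (`le_norm_of_isSeparating`). An exhaustive search
over a triangularized quadratic form shows that the listed vectors are all the short ones up to sign
(`finckePohst_sound`). `isSublatticeColoringScheme_of_certificates` assembles these facts.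

The bounds on R are proved by hand. For A_n*, sorting the coordinates and Abel summation compare a
point of V with the Weyl vector (`norm_sq_le_of_mem_voronoiCell_genA`). For E₇*, a point of V is
placed in a Weyl chamber, where the inequalities from the highest root and the minuscule weight
suffice (`norm_sq_le_of_isSimpleSystemE7`). -/

/-! ### Voronoi cells, covering radius, and from sublattice colorings to χ. -/

section LatticeGeometry

variable {E : Type*} [NormedAddCommGroup E] [InnerProductSpace ℝ E] {L L' : AddSubgroup E}

lemma mem_latticeSpan {z : E} (hz : z ∈ L) : z ∈ latticeSpan L := Submodule.subset_span hz

lemma neg_mem_voronoiCell {x : E} (hx : x ∈ voronoiCell L) : -x ∈ voronoiCell L := by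
  refine ⟨neg_mem hx.1, fun z hz => ?_⟩
  have h := hx.2 (-z) (neg_mem hz)
  rwa [norm_neg, show -x - z = -(x - -z) by abel, norm_neg]

lemma inner_le_of_mem_voronoiCell {x z : E} (hx : x ∈ voronoiCell L) (hz : z ∈ L) :
    2 * inner ℝ x z ≤ ‖z‖ ^ 2 := by
  have h := pow_le_pow_left₀ (norm_nonneg _) (hx.2 z hz) 2
  rw [norm_sub_sq_real] at h
  linarith

lemma zero_mem_voronoiCell : (0 : E) ∈ voronoiCell L :=
  ⟨zero_mem _, fun z _ => by simp⟩

/-- A lattice all of whose bounded parts are finite has a nearest point to any given point. -/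
lemma exists_sub_mem_voronoiCell (hfin : ∀ r : ℝ, {z ∈ (L : Set E) | ‖z‖ ≤ r}.Finite)
    {x : E} (hx : x ∈ latticeSpan L) : ∃ v ∈ L, x - v ∈ voronoiCell L := by
  -- A lattice point of norm above 2‖x‖ is farther from x than 0 is, so a finite minimum suffices.
  obtain ⟨v, hv, hmin⟩ := Set.exists_min_image _ (fun z => ‖x - z‖) (hfin (2 * ‖x‖))
    ⟨0, by simp⟩
  refine ⟨v, hv.1, sub_mem hx (mem_latticeSpan hv.1), fun z hz => ?_⟩
  rw [sub_sub]
  by_cases hb : ‖v + z‖ ≤ 2 * ‖x‖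
  · exact hmin _ ⟨add_mem hv.1 hz, hb⟩
  · have h0 : ‖x - v‖ ≤ ‖x - 0‖ := hmin 0 ⟨zero_mem _, by simp⟩
    have h1 : ‖v + z‖ ≤ ‖x - (v + z)‖ + ‖x‖ := by
      simpa [norm_sub_rev] using norm_le_norm_sub_add (v + z) x
    rw [sub_zero] at h0
    linarith

/-- For a cell point the nearest lattice point is 0, so every covering radius candidate is at least
its norm. The covering hypothesis makes the set of candidates nonempty, so that its infimum is
meaningful. -/
lemma norm_le_coveringRadius {r : ℝ} (hcov : ∀ x ∈ latticeSpan L, ∃ z ∈ L, dist x z ≤ r)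
    {x : E} (hx : x ∈ voronoiCell L) : ‖x‖ ≤ coveringRadius L := by
  refine le_csInf ⟨r, hcov⟩ fun s hs => ?_
  obtain ⟨z, hz, hxz⟩ := hs x hx.1
  exact (hx.2 z hz).trans (by rwa [← dist_eq_norm])

lemma coveringRadius_le {r : ℝ} (hcov : ∀ x ∈ latticeSpan L, ∃ z ∈ L, dist x z ≤ r) :
    coveringRadius L ≤ r := by
  refine csInf_le ⟨0, fun s hs => ?_⟩ hcov
  obtain ⟨z, -, hz⟩ := hs 0 (zero_mem _)
  exact dist_nonneg.trans hz

/-- A point strictly closer to `0` than to any other lattice point is interior to the Voronoi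
cell. -/
lemma mem_voronoiInterior_of_lt (hfin : ∀ r : ℝ, {z ∈ (L : Set E) | ‖z‖ ≤ r}.Finite)
    {x : E} (hx : x ∈ latticeSpan L) (h : ∀ z ∈ L, z ≠ 0 → ‖x‖ < ‖x - z‖) :
    x ∈ voronoiInterior L := by
  refine ⟨⟨hx, fun z hz => ?_⟩, ?_⟩
  · rcases eq_or_ne z 0 with rfl | h0
    · simp
    · exact (h z hz h0).le
  -- If ‖y - x‖ < 1, then ‖y‖ < ‖x‖ + 1, so lattice points of norm above 2‖x‖ + 2 cannot be nearer
  -- to y than 0 is. Only the finitely many others need a gap δ.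
  set S : Set E := {z ∈ (L : Set E) | ‖z‖ ≤ 2 * ‖x‖ + 2} \ {0}
  have hS : S.Finite := (hfin _).subset Set.sdiff_subset
  obtain ⟨δ, hδ, hgap⟩ : ∃ δ > 0, ∀ z ∈ S, δ ≤ ‖x - z‖ - ‖x‖ := by
    rcases S.eq_empty_or_nonempty with h0 | hne
    · exact ⟨1, one_pos, by simp [h0]⟩
    · obtain ⟨z₀, hz₀, hmin⟩ := Set.exists_min_image S (fun z => ‖x - z‖ - ‖x‖) hS hne
      exact ⟨_, sub_pos.2 (h z₀ hz₀.1.1 hz₀.2), hmin⟩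
  refine ⟨min 1 (δ / 2), by positivity, fun y hy hd => ⟨hy, fun z hz => ?_⟩⟩
  rw [dist_eq_norm] at hd
  have hd1 : ‖y - x‖ < 1 := hd.trans_le (min_le_left _ _)
  have hd2 : ‖y - x‖ < δ / 2 := hd.trans_le (min_le_right _ _)
  have hyx : ‖y‖ ≤ ‖y - x‖ + ‖x‖ := norm_le_norm_sub_add y x
  by_cases hb : ‖z‖ ≤ 2 * ‖x‖ + 2
  · rcases eq_or_ne z 0 with rfl | h0
    · simp
    have h1 := hgap z ⟨⟨hz, hb⟩, h0⟩
    have h2 : ‖x - z‖ ≤ ‖y - x‖ + ‖y - z‖ := by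
      rw [norm_sub_rev y x]
      exact norm_sub_le_norm_sub_add_norm_sub x y z
    linarith
  · have h1 : ‖z‖ ≤ ‖y - z‖ + ‖y‖ := by
      simpa [norm_sub_rev] using norm_le_norm_sub_add z y
    linarith

/-- This radial room is what makes the bound by R strict on the open cell in
`norm_lt_coveringRadius`. -/
lemma exists_one_lt_smul_mem_voronoiCell {x : E} (hx : x ∈ voronoiInterior L) :
    ∃ t > (1 : ℝ), t • x ∈ voronoiCell L := by
  obtain ⟨hV, ε, hε, hball⟩ := hx
  refine ⟨1 + ε / (2 * (‖x‖ + 1)), by simp; positivity, hball _ (Submodule.smul_mem _ _ hV.1) ?_⟩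
  rw [dist_eq_norm, add_smul, one_smul, add_sub_cancel_left, norm_smul, Real.norm_of_nonneg
    (by positivity), div_mul_eq_mul_div, div_lt_iff₀ (by positivity)]
  nlinarith [norm_nonneg x]

lemma coveringRadius_pos (hfin : ∀ r : ℝ, {z ∈ (L : Set E) | ‖z‖ ≤ r}.Finite)
    {r : ℝ} (hcov : ∀ x ∈ latticeSpan L, ∃ z ∈ L, dist x z ≤ r) (hne : latticeSpan L ≠ ⊥) :
    0 < coveringRadius L := by
  obtain ⟨-, ε, hε, hball⟩ := mem_voronoiInterior_of_lt hfin (zero_mem _)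
    (fun z _ h0 => by simpa using h0)
  obtain ⟨y, hy, hy0⟩ := (Submodule.ne_bot_iff _).1 hne
  have hn : 0 < ‖y‖ := norm_pos_iff.2 hy0
  have hm : (ε / (2 * ‖y‖)) • y ∈ voronoiCell L := by
    refine hball _ (Submodule.smul_mem _ _ hy) ?_
    rw [dist_zero_right, norm_smul, Real.norm_of_nonneg (by positivity)]
    field_simp
    linarith
  refine lt_of_lt_of_le ?_ (norm_le_coveringRadius hcov hm)
  rw [norm_pos_iff]
  exact smul_ne_zero (by positivity) hy0

lemma norm_lt_coveringRadius {r : ℝ} (hcov : ∀ x ∈ latticeSpan L, ∃ z ∈ L, dist x z ≤ r)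
    (hR : 0 < coveringRadius L) {x : E} (hx : x ∈ voronoiInterior L) :
    ‖x‖ < coveringRadius L := by
  obtain ⟨t, ht, htx⟩ := exists_one_lt_smul_mem_voronoiCell hx
  have h := norm_le_coveringRadius hcov htx
  rw [norm_smul, Real.norm_of_nonneg (by linarith)] at h
  nlinarith [norm_nonneg x]

/-- If the Voronoi cells around `0` and around every nonzero vector of the sublattice are at
distance at least `2R`, then the sublattice coloring has no monochromatic pair at distance `2R`. -/
theorem sublatticeColoringAvoids_of_cell_dist {r : ℝ}
    (hcov : ∀ x ∈ latticeSpan L, ∃ z ∈ L, dist x z ≤ r) (hR : 0 < coveringRadius L)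
    (hcell : ∀ v ∈ L', v ≠ 0 →
      2 * coveringRadius L ≤ setDist (voronoiCell L) ((fun x => v + x) '' voronoiCell L)) :
    SublatticeColoringAvoids L L' (2 * coveringRadius L) := by
  intro v hv w hw hvw x hx y hy hd
  rcases eq_or_ne v w with rfl | hne
  · rw [dist_add_left, dist_eq_norm] at hd
    linarith [norm_sub_le x y, norm_lt_coveringRadius hcov hR hx,
      norm_lt_coveringRadius hcov hR hy]
  · set d : E := v + x - (w + y)
    have hdn : ‖d‖ = 2 * coveringRadius L := by rw [← hd, dist_eq_norm]
    obtain ⟨hxV, ε, hε, hball⟩ := hx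
    have hdX : d ∈ latticeSpan L :=
      sub_mem (add_mem (mem_latticeSpan hv) hxV.1) (add_mem (mem_latticeSpan hw) hy.1.1)
    -- Moving x towards the other point by τ d stays in the cell and shortens the distance to (1 -
    -- τ)·2R, which contradicts the distance between the cells.
    set τ : ℝ := min (1 / 2) (ε / (2 * ‖d‖))
    have hd0 : 0 < ‖d‖ := by linarith
    have hτ : 0 < τ := by positivity
    have hτ1 : τ ≤ 1 / 2 := min_le_left _ _
    have hτ2 : τ * ‖d‖ ≤ ε / 2 := by
      calc τ * ‖d‖ ≤ ε / (2 * ‖d‖) * ‖d‖ := by gcongr; exact min_le_right _ _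
        _ = ε / 2 := by field_simp
    have hx' : x - τ • d ∈ voronoiCell L := by
      refine hball _ (sub_mem hxV.1 (Submodule.smul_mem _ _ hdX)) ?_
      rw [dist_eq_norm, sub_sub_cancel_left, norm_neg, norm_smul, Real.norm_of_nonneg hτ.le]
      linarith
    have h := (hcell _ hvw (sub_ne_zero.2 hne)).trans
      (csInf_le ⟨0, by rintro _ ⟨a, -, b, -, rfl⟩; exact dist_nonneg⟩
        ⟨y, hy.1, _, ⟨_, hx', rfl⟩, rfl⟩)
    rw [dist_comm, dist_eq_norm, show v - w + (x - τ • d) - y = (1 - τ) • d by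
      rw [sub_smul, one_smul]; simp only [d]; abel, norm_smul,
      Real.norm_of_nonneg (by linarith)] at h
    nlinarith

/-- A finite set of points of the span of a lattice can be translated so that every point lies in
the interior of a translate of the Voronoi cell by a lattice vector. -/
lemma exists_translate_mem_voronoiInterior
    (hfin : ∀ r : ℝ, {z ∈ (L : Set E) | ‖z‖ ≤ r}.Finite) {n : ℕ}
    (φ : EuclideanSpace ℝ (Fin n) ≃ₗᵢ[ℝ] latticeSpan L) {P : Set (EuclideanSpace ℝ (Fin n))}
    (hP : P.Countable) :
    ∃ t, ∀ p ∈ P, ∃ v ∈ L, (φ (p + t) : E) - v ∈ voronoiInterior L := by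
  have hL : (L : Set E).Countable := by
    have : (L : Set E) = ⋃ k : ℕ, {z ∈ (L : Set E) | ‖z‖ ≤ k} := by
      ext z
      simpa using fun _ => exists_nat_ge ‖z‖
    rw [this]
    exact Set.countable_iUnion fun k => (hfin k).countable
  have : Countable L := hL.to_subtype
  have : Countable P := hP.to_subtype
  -- For fixed p, v and z ≠ 0, the translations making φ (p + t) - v equidistant from 0 and z form a
  -- hyperplane, hence a null set. Countably many of these do not fill the space.
  let bad (i : P × L × L) : Set (EuclideanSpace ℝ (Fin n)) :=
    {t | i.2.2.1 ≠ 0 ∧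
      2 * inner ℝ (φ (i.1.1 + t) - i.2.1.1 : E) i.2.2.1 = ‖i.2.2.1‖ ^ 2}
  have hbad : ∀ i, MeasureTheory.volume (bad i) = 0 := by
    rintro ⟨p, v, z⟩
    rcases eq_or_ne z.1 0 with h0 | h0
    · rw [Set.eq_empty_of_forall_notMem fun t (ht : t ∈ bad (p, v, z)) => ht.1 h0,
        MeasureTheory.measure_empty]
    let u : EuclideanSpace ℝ (Fin n) := φ.symm ⟨z.1, mem_latticeSpan z.2⟩
    have hu : ∀ t, inner ℝ (φ t : E) z.1 = inner ℝ t u := by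
      intro t
      rw [← φ.inner_map_map t u]
      simp [u]
    have hu0 : inner ℝ u u ≠ 0 := by
      rw [← hu]
      simpa [u] using h0
    let c : ℝ := ‖z.1‖ ^ 2 / 2 - inner ℝ (φ p - v : E) z.1
    let A : AffineSubspace ℝ (EuclideanSpace ℝ (Fin n)) :=
      { carrier := {t | inner ℝ t u = c}
        smul_vsub_vadd_mem' := by
          intro a x y w hx hy hw
          simp only [Set.mem_ofPred_eq] at hx hy hw ⊢
          simp [inner_add_left, inner_sub_left, inner_smul_left, hx, hy, hw] }
    have hA : bad (p, v, z) ⊆ A := by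
      rintro t ⟨-, ht⟩
      change inner ℝ t u = c
      rw [← hu]
      simp only [map_add, Submodule.coe_add, c, inner_sub_left, inner_add_left] at ht ⊢
      linarith
    refine MeasureTheory.measure_mono_null hA
      (MeasureTheory.Measure.addHaar_affineSubspace _ _ fun h => ?_)
    have h1 : (0 : EuclideanSpace ℝ (Fin n)) ∈ A := h ▸ AffineSubspace.mem_top ℝ _ _
    have h2 : u ∈ A := h ▸ AffineSubspace.mem_top ℝ _ _
    change inner ℝ 0 u = c at h1
    change inner ℝ u u = c at h2
    rw [inner_zero_left] at h1
    exact hu0 (h2.trans h1.symm)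
  obtain ⟨t, ht⟩ : ∃ t, t ∉ ⋃ i, bad i := by
    by_contra! h
    have h1 : MeasureTheory.volume (⋃ i, bad i) = 0 := MeasureTheory.measure_iUnion_null hbad
    rw [Set.eq_univ_of_forall h] at h1
    exact (isOpen_univ.measure_ne_zero MeasureTheory.volume Set.univ_nonempty) h1
  refine ⟨t, fun p hp => ?_⟩
  obtain ⟨v, hv, hV⟩ := exists_sub_mem_voronoiCell hfin (φ (p + t)).2
  refine ⟨v, hv, mem_voronoiInterior_of_lt hfin hV.1 fun z hz h0 => ?_⟩
  refine lt_of_le_of_ne (hV.2 z hz) fun heq => ht ?_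
  refine Set.mem_iUnion.2 ⟨(⟨p, hp⟩, ⟨v, hv⟩, ⟨z, hz⟩), h0, ?_⟩
  have := congrArg (· ^ 2) heq
  simp only [norm_sub_sq_real ((φ (p + t) : E) - v)] at this
  simp only
  linarith

/-- A sublattice coloring avoiding the distance `2R > 0` colors the space of the dimension of the
lattice with as many colors as the index. -/
theorem chiEuclidean_le_of_isSublatticeColoringScheme
    (hfin : ∀ r : ℝ, {z ∈ (L : Set E) | ‖z‖ ≤ r}.Finite) {n N : ℕ} (hn : n ≠ 0) (hN : N ≠ 0)
    (hR : 0 < coveringRadius L) (h : IsSublatticeColoringScheme L L' n N) :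
    chiEuclidean n ≤ N := by
  have : FiniteDimensional ℝ (latticeSpan L) :=
    Module.finite_of_finrank_pos (by rw [h.rank_eq]; omega)
  let φ : EuclideanSpace ℝ (Fin n) ≃ₗᵢ[ℝ] latticeSpan L :=
    ((stdOrthonormalBasis ℝ (latticeSpan L)).reindex (finCongr h.rank_eq)).repr.symm
  have hcard : Nat.card (L ⧸ L'.addSubgroupOf L) = N := h.index_eq
  have : Finite (L ⧸ L'.addSubgroupOf L) := Nat.finite_of_card_ne_zero (by rwa [hcard])
  set ℓ : ℝ := 2 * coveringRadius L
  have hℓ : 0 < ℓ := by positivity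
  have hhom : Nonempty (unitDistanceGraph (EuclideanSpace ℝ (Fin n)) →g
      (⊤ : SimpleGraph (L ⧸ L'.addSubgroupOf L))) := by
    -- De Bruijn–Erdős compactness; the finite target is the complete graph on Λ/Λ'. Each finite set
    -- is scaled by ℓ = 2R, so that unit distances become 2R.
    refine SimpleGraph.nonempty_hom_of_forall_finite_subgraph_hom fun G' hG' => ?_
    have ht := exists_translate_mem_voronoiInterior hfin φ (hG'.image (ℓ • ·)).countable
    choose t ht using ht
    have ht' : ∀ p : G'.verts, ∃ v : L, (φ (ℓ • p.1 + t) : E) - v ∈ voronoiInterior L := by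
      intro p
      obtain ⟨v, hv, h'⟩ := ht _ ⟨p.1, p.2, rfl⟩
      exact ⟨⟨v, hv⟩, h'⟩
    choose c hc using ht'
    refine ⟨fun p => (c p : L ⧸ L'.addSubgroupOf L), fun {p q} hpq => ?_⟩
    rw [SimpleGraph.top_adj]
    intro heq
    have hmem : (c p : E) - c q ∈ L' := by
      have := QuotientAddGroup.eq.1 heq.symm
      rw [AddSubgroup.mem_addSubgroupOf] at this
      simpa [sub_eq_neg_add] using this
    refine h.avoids _ (c p).2 _ (c q).2 hmem _ (hc p) _ (hc q) ?_
    have hd : dist p.1 q.1 = 1 := G'.adj_sub hpq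
    rw [add_sub_cancel, add_sub_cancel, ← Subtype.dist_eq, φ.dist_map, dist_add_right,
      dist_smul₀, hd, mul_one, Real.norm_of_nonneg hℓ.le]
  obtain ⟨f⟩ := hhom
  have := Fintype.ofFinite (L ⧸ L'.addSubgroupOf L)
  have hc : (unitDistanceGraph (EuclideanSpace ℝ (Fin n))).Colorable
      (Fintype.card (L ⧸ L'.addSubgroupOf L)) := SimpleGraph.Coloring.colorable f
  rw [← Nat.card_eq_fintype_card, hcard] at hc
  exact hc.chromaticNumber_le

end LatticeGeometry

/-! ### Lattices given by generator matrices: discreteness, rank, index, Gram form. -/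

section MatrixLattices

variable {m n : ℕ}

/-- The point `M k` of the lattice `M ℤⁿ`, as an additive map. -/
def latticePoint (M : Matrix (Fin m) (Fin n) ℝ) :
    (Fin n → ℤ) →+ EuclideanSpace ℝ (Fin m) where
  toFun k := WithLp.toLp 2 (M.mulVec fun j => (k j : ℝ))
  map_zero' := by ext i; simp [Matrix.mulVec, dotProduct]
  map_add' k l := by
    ext i
    simp [Matrix.mulVec, dotProduct, mul_add, Finset.sum_add_distrib]

variable {M : Matrix (Fin m) (Fin n) ℝ}

lemma latticePoint_apply (k : Fin n → ℤ) (i : Fin m) :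
    latticePoint M k i = ∑ j, M i j * (k j : ℝ) := rfl

lemma ofLp_latticePoint (k : Fin n → ℤ) :
    (latticePoint M k).ofLp = M.mulVec fun j => (k j : ℝ) := rfl

lemma latticePoint_mem (k : Fin n → ℤ) : latticePoint M k ∈ matrixLattice M := ⟨k, rfl⟩

lemma matrixLattice_eq_range : matrixLattice M = (latticePoint M).range := by
  ext x
  exact exists_congr fun k => eq_comm

lemma matrixLattice_mul_eq (C : Matrix (Fin n) (Fin n) ℤ) :
    matrixLattice (M * C.map (fun z : ℤ => (z : ℝ))) =
      (C.mulVecLin.toAddMonoidHom.range).map (latticePoint M) := by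
  have key : ∀ k : Fin n → ℤ,
      latticePoint (M * C.map (fun z : ℤ => (z : ℝ))) k = latticePoint M (C.mulVec k) := by
    intro k
    ext i
    rw [ofLp_latticePoint, ofLp_latticePoint, ← Matrix.mulVec_mulVec]
    congr 2
    ext j
    simp [Matrix.mulVec, dotProduct]
  rw [matrixLattice_eq_range]
  ext x
  constructor
  · rintro ⟨k, rfl⟩
    exact ⟨C.mulVec k, ⟨k, rfl⟩, (key k).symm⟩
  · rintro ⟨_, ⟨k, rfl⟩, rfl⟩
    exact ⟨k, key k⟩

section LeftInverse

variable {P : Matrix (Fin n) (Fin m) ℝ} (hP : P * M = 1)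
include hP

lemma mulVec_latticePoint (k : Fin n → ℤ) :
    P.mulVec (latticePoint M k) = fun j => (k j : ℝ) := by
  rw [ofLp_latticePoint, Matrix.mulVec_mulVec, hP, Matrix.one_mulVec]

lemma latticePoint_injective : Function.Injective (latticePoint M) := by
  intro k l h
  have := (mulVec_latticePoint hP k).symm.trans (h ▸ mulVec_latticePoint hP l)
  ext j
  exact_mod_cast congrFun this j

/-- The left inverse P recovers the integer coordinates of a lattice point, so the norm bounds each
of them. -/
lemma finite_matrixLattice_inter_ball (r : ℝ) :
    {z ∈ (matrixLattice M : Set (EuclideanSpace ℝ (Fin m))) | ‖z‖ ≤ r}.Finite := by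
  let B : Fin n → ℤ := fun j => ⌈(∑ i, |P j i|) * r⌉
  refine ((Set.finite_Icc (-B) B).image (latticePoint M)).subset ?_
  rintro _ ⟨⟨k, rfl⟩, hk⟩
  have hb : ∀ j, |k j| ≤ B j := by
    intro j
    have h := congrFun (mulVec_latticePoint hP k) j
    have h1 : |(k j : ℝ)| ≤ (∑ i, |P j i|) * r := by
      rw [← h, Matrix.mulVec, dotProduct, Finset.sum_mul]
      refine (Finset.abs_sum_le_sum_abs _ _).trans (Finset.sum_le_sum fun i _ => ?_)
      rw [abs_mul]
      exact mul_le_mul_of_nonneg_left ((PiLp.norm_apply_le _ i).trans hk) (abs_nonneg _)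
    exact_mod_cast h1.trans (Int.le_ceil _)
  exact ⟨k, ⟨fun j => (abs_le.1 (hb j)).1, fun j => (abs_le.1 (hb j)).2⟩, rfl⟩

lemma finrank_latticeSpan_matrixLattice :
    Module.finrank ℝ (latticeSpan (matrixLattice M)) = n := by
  let f : (Fin n → ℝ) →ₗ[ℝ] EuclideanSpace ℝ (Fin m) :=
    (WithLp.linearEquiv 2 ℝ (Fin m → ℝ)).symm.toLinearMap ∘ₗ M.mulVecLin
  have hf : Function.Injective f := by
    intro x y h
    have h1 : M.mulVec x = M.mulVec y := by
      simpa [f] using h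
    have h2 := congrArg P.mulVec h1
    simpa [Matrix.mulVec_mulVec, hP] using h2
  have hspan : latticeSpan (matrixLattice M) = LinearMap.range f := by
    apply le_antisymm
    · refine Submodule.span_le.2 ?_
      rintro _ ⟨k, rfl⟩
      exact ⟨fun j => (k j : ℝ), rfl⟩
    · rintro _ ⟨x, rfl⟩
      rw [← (Pi.basisFun ℝ (Fin n)).sum_repr x, map_sum]
      refine Submodule.sum_mem _ fun j _ => ?_
      rw [map_smul]
      refine Submodule.smul_mem _ _ (Submodule.subset_span ⟨Pi.single j 1, ?_⟩)
      rw [Pi.basisFun_apply]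
      change WithLp.toLp 2 (M.mulVec _) = _
      congr 2
      ext i
      rcases eq_or_ne i j with rfl | hij <;> simp [*]
  rw [hspan, LinearMap.finrank_range_of_inj hf, Module.finrank_fin_fun]

/-- Since M is injective on ℤⁿ, the index is that of C ℤⁿ in ℤⁿ. -/
lemma relIndex_matrixLattice_mul {C : Matrix (Fin n) (Fin n) ℤ} (hC : C.det ≠ 0) :
    (matrixLattice (M * C.map (fun z : ℤ => (z : ℝ)))).relIndex (matrixLattice M) =
      C.det.natAbs := by
  rw [matrixLattice_mul_eq, matrixLattice_eq_range, (latticePoint M).range_eq_map,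
    AddSubgroup.relIndex_map_map_of_injective _ _ (latticePoint_injective hP),
    AddSubgroup.relIndex_top_right]
  have hinj : Function.Injective C.mulVecLin := Matrix.mulVec_injective_of_det_ne_zero hC
  have h := Submodule.natAbs_det_equiv (LinearMap.range C.mulVecLin)
    (LinearEquiv.ofInjective C.mulVecLin hinj)
  rw [show LinearMap.det ((LinearMap.range C.mulVecLin).subtype ∘ₗ
      AddMonoidHom.toIntLinearMap
        ((LinearEquiv.ofInjective C.mulVecLin hinj : _ →+ LinearMap.range C.mulVecLin))) =
      C.det by rw [← LinearMap.det_toLin']; congr 1] at h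
  rw [h]
  rfl

end LeftInverse

lemma inner_latticePoint {G : Matrix (Fin n) (Fin n) ℤ} {s : ℕ}
    (hG : (s : ℝ) • (M.transpose * M) = G.map (fun z : ℤ => (z : ℝ))) (k l : Fin n → ℤ) :
    (s : ℝ) * inner ℝ (latticePoint M k) (latticePoint M l) = (k ⬝ᵥ G.mulVec l : ℤ) := by
  have hcast : ((k ⬝ᵥ G.mulVec l : ℤ) : ℝ) =
      (fun j => (k j : ℝ)) ⬝ᵥ (G.map (fun z : ℤ => (z : ℝ))).mulVec fun j => (l j : ℝ) := by
    simp [dotProduct, Matrix.mulVec]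
  rw [hcast, ← hG, Matrix.smul_mulVec, dotProduct_smul, ← Matrix.mulVec_mulVec,
    Matrix.dotProduct_mulVec, Matrix.vecMul_transpose, smul_eq_mul,
    EuclideanSpace.inner_eq_star_dotProduct, star_trivial, dotProduct_comm]
  rfl

lemma norm_latticePoint_sq {G : Matrix (Fin n) (Fin n) ℤ} {s : ℕ}
    (hG : (s : ℝ) • (M.transpose * M) = G.map (fun z : ℤ => (z : ℝ))) (k : Fin n → ℤ) :
    (s : ℝ) * ‖latticePoint M k‖ ^ 2 = (k ⬝ᵥ G.mulVec k : ℤ) := by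
  rw [← real_inner_self_eq_norm_sq, inner_latticePoint hG]

end MatrixLattices

/-! ### Verified enumeration of short vectors. -/

section Search

/-- The dot product of two lists, truncated to the shorter one. -/
def listDot : List ℤ → List ℤ → ℤ
  | a :: as, b :: bs => a * b + listDot as bs
  | _, _ => 0

/-- The value of a quadratic form written as a weighted sum of squares of triangular linear forms.
A row `(w, β, m)` stands for the square `w (β x + m · ks)²`, where `x` is the current variable and
`ks` lists the variables already fixed. -/
def triangularForm : List (ℕ × ℕ × List ℤ) → List ℤ → List ℤ → ℤ
  | (w, β, m) :: rows, ks, x :: xs =>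
    w * (β * x + listDot m ks) ^ 2 + triangularForm rows (x :: ks) xs
  | _, _, _ => 0

/-- Fincke–Pohst search: checks `p` at all integer vectors with entries in `[-K, K]` at which the
form is less than `bound`, and checks that larger entries exceed the bound. -/
def finckePohst (K : ℕ) (p : List ℤ → Bool) : List (ℕ × ℕ × List ℤ) → ℤ → List ℤ → Bool
  | [], _, ks => p ks
  | (w, β, m) :: rows, bound, ks =>
    decide (0 ≤ β * ((K : ℤ) + 1) + listDot m ks) &&
    decide (bound ≤ w * (β * ((K : ℤ) + 1) + listDot m ks) ^ 2) &&
    decide (β * (-(K : ℤ) - 1) + listDot m ks ≤ 0) &&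
    decide (bound ≤ w * (β * (-(K : ℤ) - 1) + listDot m ks) ^ 2) &&
    (List.range (2 * K + 1)).all fun i =>
      decide (bound ≤ w * (β * ((i : ℤ) - K) + listDot m ks) ^ 2) ||
      finckePohst K p rows (bound - w * (β * ((i : ℤ) - K) + listDot m ks) ^ 2)
        (((i : ℤ) - K) :: ks)

lemma triangularForm_nonneg (rows : List (ℕ × ℕ × List ℤ)) (ks xs : List ℤ) :
    0 ≤ triangularForm rows ks xs := by
  induction rows generalizing ks xs with
  | nil => simp [triangularForm]
  | cons r rows ih =>
    cases xs with
    | nil => simp [triangularForm]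
    | cons x xs =>
      have := ih (x :: ks) xs
      simp only [triangularForm]
      positivity

/-- Each square is nonnegative, so subtracting those already fixed leaves a valid bound for the
remaining ones. Newly fixed variables are put at the head of `ks`, which explains the reversal. -/
theorem finckePohst_sound {K : ℕ} {p : List ℤ → Bool} (rows : List (ℕ × ℕ × List ℤ)) (bound : ℤ)
    (ks xs : List ℤ) (hlen : xs.length = rows.length)
    (h : finckePohst K p rows bound ks = true) (hlt : triangularForm rows ks xs < bound) :
    p (xs.reverse ++ ks) = true := by
  induction rows generalizing bound ks xs with
  | nil =>
    obtain rfl : xs = [] := List.length_eq_zero_iff.1 hlen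
    simpa [finckePohst] using h
  | cons r rows ih =>
    obtain ⟨w, β, m⟩ := r
    cases xs with
    | nil => simp at hlen
    | cons x xs =>
      simp only [finckePohst, Bool.and_eq_true, decide_eq_true_eq, List.all_eq_true,
        List.mem_range, Bool.or_eq_true] at h
      obtain ⟨⟨⟨⟨h1, h2⟩, h3⟩, h4⟩, h5⟩ := h
      simp only [triangularForm] at hlt
      set t := listDot m ks
      have hrest := triangularForm_nonneg rows (x :: ks) xs
      -- The tests at ±(K + 1) also control all larger entries: there β x + t has a definite sign
      -- and its square does not decrease away from the box.
      have hx1 : x ≤ K := by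
        by_contra! hc
        have h6 : (β : ℤ) * ((K : ℤ) + 1) ≤ β * x := by gcongr; omega
        have h7 : (w : ℤ) * (β * ((K : ℤ) + 1) + t) ^ 2 ≤ w * (β * x + t) ^ 2 := by gcongr
        linarith
      have hx2 : -(K : ℤ) ≤ x := by
        by_contra! hc
        have h6 : (β : ℤ) * x ≤ β * (-(K : ℤ) - 1) := by gcongr; omega
        have h7 : (β * (-(K : ℤ) - 1) + t) ^ 2 ≤ (β * x + t) ^ 2 := by nlinarith
        have h8 : (w : ℤ) * (β * (-(K : ℤ) - 1) + t) ^ 2 ≤ w * (β * x + t) ^ 2 := by gcongr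
        linarith
      have h9 := h5 (x + K).toNat (by omega)
      rw [Int.toNat_of_nonneg (by omega), add_sub_cancel_right] at h9
      rcases h9 with h9 | h9
      · linarith
      · have := ih _ _ xs (by simpa using hlen) h9 (by linarith)
        simpa using this

end Search

/-! ### Separating directions and the finite criterion for a coloring scheme. -/

section Certificates

variable {m n : ℕ} {M : Matrix (Fin m) (Fin n) ℝ} {G : Matrix (Fin n) (Fin n) ℤ} {s : ℕ}

/-- The lattice vector `∑ c z` of a list of pairs `(c, z)`, in coordinates. -/
def conicSum (terms : List (ℕ × (Fin n → ℤ))) : Fin n → ℤ :=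
  (terms.map fun t => t.1 • t.2).sum

/-- A direction `∑ c z` which separates the Voronoi cells around `0` and around the lattice vector
with coordinates `v`, by a distance whose square is at least `ρ / s`; here `G` is `s` times the Gram
matrix of the lattice. -/
def IsSeparating (G : Matrix (Fin n) (Fin n) ℤ) (ρ : ℕ) (v : Fin n → ℤ)
    (terms : List (ℕ × (Fin n → ℤ))) : Prop :=
  (terms.map fun t => (t.1 : ℤ) * (t.2 ⬝ᵥ G.mulVec t.2)).sum < v ⬝ᵥ G.mulVec (conicSum terms) ∧
  ρ * (conicSum terms ⬝ᵥ G.mulVec (conicSum terms)) ≤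
    (v ⬝ᵥ G.mulVec (conicSum terms) -
      (terms.map fun t => (t.1 : ℤ) * (t.2 ⬝ᵥ G.mulVec t.2)).sum) ^ 2

instance (ρ : ℕ) (v : Fin n → ℤ) (terms : List (ℕ × (Fin n → ℤ))) :
    Decidable (IsSeparating G ρ v terms) := by
  unfold IsSeparating
  infer_instance

/-- The half-space inequalities 2⟨x, z⟩ ≤ |z|² of the cell may be added with the nonnegative weights
c. -/
lemma inner_conicSum_le (hG : (s : ℝ) • (M.transpose * M) = G.map (fun z : ℤ => (z : ℝ)))
    {x : EuclideanSpace ℝ (Fin m)} (hx : x ∈ voronoiCell (matrixLattice M))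
    (terms : List (ℕ × (Fin n → ℤ))) :
    2 * s * inner ℝ x (latticePoint M (conicSum terms)) ≤
      ((terms.map fun t => (t.1 : ℤ) * (t.2 ⬝ᵥ G.mulVec t.2)).sum : ℤ) := by
  induction terms with
  | nil => simp [conicSum]
  | cons t terms ih =>
    have h := inner_le_of_mem_voronoiCell hx (latticePoint_mem t.2)
    have h2 : (t.1 * s : ℝ) * (2 * inner ℝ x (latticePoint M t.2)) ≤
        t.1 * s * ‖latticePoint M t.2‖ ^ 2 := by gcongr
    rw [mul_assoc _ (s : ℝ), mul_assoc _ (s : ℝ), norm_latticePoint_sq hG] at h2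
    have h3 : conicSum (t :: terms) = t.1 • t.2 + conicSum terms := by simp [conicSum]
    rw [h3, map_add, map_nsmul, inner_add_right, ← Nat.cast_smul_eq_nsmul ℝ, inner_smul_right]
    simp only [List.map_cons, List.sum_cons, Int.cast_add, Int.cast_mul, Int.cast_natCast]
    linarith

/-- A separating direction bounds the distance between Voronoi cells from below. -/
lemma le_norm_of_isSeparating (hs : 0 < s)
    (hG : (s : ℝ) • (M.transpose * M) = G.map (fun z : ℤ => (z : ℝ)))
    {ρ : ℕ} {v : Fin n → ℤ} {terms : List (ℕ × (Fin n → ℤ))} (h : IsSeparating G ρ v terms)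
    {x y : EuclideanSpace ℝ (Fin m)} (hx : x ∈ voronoiCell (matrixLattice M))
    (hy : y ∈ voronoiCell (matrixLattice M)) :
    (ρ : ℝ) ≤ s * ‖latticePoint M v + y - x‖ ^ 2 := by
  obtain ⟨h1, h2⟩ := h
  set W : ℤ := (terms.map fun t => (t.1 : ℤ) * (t.2 ⬝ᵥ G.mulVec t.2)).sum
  set u := latticePoint M (conicSum terms)
  have hx' := inner_conicSum_le hG hx terms
  have hy' := inner_conicSum_le hG (neg_mem_voronoiCell hy) terms
  rw [inner_neg_left] at hy'
  have hs' : (0 : ℝ) < s := by exact_mod_cast hs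
  set S : ℝ := s * inner ℝ (latticePoint M v) u - W
  have hS : S = ((v ⬝ᵥ G.mulVec (conicSum terms) - W : ℤ) : ℝ) := by
    simp only [S, u, inner_latticePoint hG]
    push_cast
    rfl
  have hSpos : 0 < S := by
    rw [hS]
    exact_mod_cast sub_pos.2 h1
  have h3 : (ρ : ℝ) * (s * ‖u‖ ^ 2) ≤ S ^ 2 := by
    rw [hS, norm_latticePoint_sq hG]
    exact_mod_cast h2
  set d := latticePoint M v + y - x
  have h4 : S ≤ s * inner ℝ d u := by
    simp only [d, inner_sub_left, inner_add_left, S, u]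
    linarith
  have h5 : s * inner ℝ d u ≤ s * (‖d‖ * ‖u‖) := by
    gcongr
    exact real_inner_le_norm d u
  have h6 : S ^ 2 ≤ (s * (‖d‖ * ‖u‖)) ^ 2 := by
    gcongr
    exact h4.trans h5
  have hu : 0 < ‖u‖ := by
    by_contra! hc
    have : ‖u‖ = 0 := le_antisymm hc (norm_nonneg _)
    rw [this] at h5
    linarith
  have h7 : (s * ‖u‖ ^ 2) * ρ ≤ (s * ‖u‖ ^ 2) * (s * ‖d‖ ^ 2) := by nlinarith
  exact le_of_mul_le_mul_left h7 (by positivity)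

/-- The criterion for a sublattice coloring scheme: the sublattice is generated by `M C`, the
covering radius squared is at most `ρ / (4 s)`, and all vectors of the sublattice of norm less than
`4R` are covered by separating directions. -/
theorem isSublatticeColoringScheme_of_certificates {P : Matrix (Fin n) (Fin m) ℝ} (hP : P * M = 1)
    (hn : n ≠ 0) (hs : 0 < s) (hG : (s : ℝ) • (M.transpose * M) = G.map (fun z : ℤ => (z : ℝ)))
    {C : Matrix (Fin n) (Fin n) ℤ} {N : ℕ} (hC : C.det.natAbs = N) (hN : N ≠ 0) {ρ : ℕ}
    (hcov : ∀ x ∈ voronoiCell (matrixLattice M), 4 * s * ‖x‖ ^ 2 ≤ ρ)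
    {K D : ℕ} {rows : List (ℕ × ℕ × List ℤ)}
    {certs : List ((Fin n → ℤ) × List (ℕ × (Fin n → ℤ)))} (hrows : rows.length = n) (hD : 0 < D)
    (hform : ∀ k : Fin n → ℤ, triangularForm rows [] (List.ofFn k).reverse =
      D * (C.mulVec k ⬝ᵥ G.mulVec (C.mulVec k)))
    (hsearch : finckePohst K (fun ks => ks.all (· == 0) || certs.any fun c =>
      List.ofFn c.1 == ks || List.ofFn (-c.1) == ks) rows (D * (4 * ρ)) [] = true)
    (hcert : ∀ c ∈ certs, IsSeparating G ρ (C.mulVec c.1) c.2) :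
    IsSublatticeColoringScheme (matrixLattice M)
        (matrixLattice (M * C.map (fun z : ℤ => (z : ℝ)))) n N ∧ chiEuclidean n ≤ N := by
  have hfin := finite_matrixLattice_inter_ball hP
  have hs' : (0 : ℝ) < s := by exact_mod_cast hs
  -- Here r is only an upper bound for R; all separations are proved with 2r, which is stronger than
  -- 2R.
  set r : ℝ := √(ρ / (4 * s))
  have hr : ∀ x ∈ voronoiCell (matrixLattice M), ‖x‖ ≤ r := by
    intro x hx
    refine Real.le_sqrt_of_sq_le ?_
    rw [le_div_iff₀ (by positivity)]
    linarith [hcov x hx]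
  have hr2 : s * (2 * r) ^ 2 = ρ := by
    rw [mul_pow, Real.sq_sqrt (by positivity)]
    field_simp
    ring
  have hcov' : ∀ x ∈ latticeSpan (matrixLattice M), ∃ z ∈ matrixLattice M, dist x z ≤ r := by
    intro x hx
    obtain ⟨v, hv, hxv⟩ := exists_sub_mem_voronoiCell hfin hx
    exact ⟨v, hv, by rw [dist_eq_norm]; exact hr _ hxv⟩
  have hrank := finrank_latticeSpan_matrixLattice hP
  have hpos : 0 < coveringRadius (matrixLattice M) := by
    refine coveringRadius_pos hfin hcov' fun h => hn ?_
    rw [← hrank, h, finrank_bot]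
  have hle : matrixLattice (M * C.map (fun z : ℤ => (z : ℝ))) ≤ matrixLattice M := by
    rw [matrixLattice_mul_eq, matrixLattice_eq_range]
    rintro _ ⟨k, -, rfl⟩
    exact ⟨k, rfl⟩
  have hsep : ∀ k : Fin n → ℤ, k ≠ 0 → ∀ x ∈ voronoiCell (matrixLattice M),
      ∀ y ∈ voronoiCell (matrixLattice M),
      2 * r ≤ ‖latticePoint M (C.mulVec k) + y - x‖ := by
    intro k hk x hx y hy
    have hr0 : 0 ≤ r := Real.sqrt_nonneg _
    have of_cert : ∀ c ∈ certs, ∀ x ∈ voronoiCell (matrixLattice M),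
        ∀ y ∈ voronoiCell (matrixLattice M),
        2 * r ≤ ‖latticePoint M (C.mulVec c.1) + y - x‖ := by
      intro c hc x hx y hy
      have h := le_norm_of_isSeparating hs hG (hcert c hc) hx hy
      rw [← hr2] at h
      exact (sq_le_sq₀ (by positivity) (norm_nonneg _)).1 (le_of_mul_le_mul_left h hs')
    -- The threshold says |v| ≥ 4r, since 16 r² = 4ρ/s; both cells have circumradius at most r, so
    -- such v need no certificate.
    rcases le_or_gt ((4 * ρ : ℕ) : ℤ) (C.mulVec k ⬝ᵥ G.mulVec (C.mulVec k)) with hbig | hsmall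
    · have h1 : ((4 * ρ : ℕ) : ℝ) ≤ s * ‖latticePoint M (C.mulVec k)‖ ^ 2 := by
        rw [norm_latticePoint_sq hG]
        exact_mod_cast hbig
      push_cast at h1
      have h2 : (4 * r) ^ 2 ≤ ‖latticePoint M (C.mulVec k)‖ ^ 2 := by
        refine le_of_mul_le_mul_left ?_ hs'
        linarith
      have h3 := (sq_le_sq₀ (by positivity) (norm_nonneg _)).1 h2
      have h4 : ‖latticePoint M (C.mulVec k)‖ ≤
          ‖latticePoint M (C.mulVec k) + y - x‖ + ‖x - y‖ := by
        have := norm_add_le (latticePoint M (C.mulVec k) + y - x) (x - y)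
        rwa [sub_add_sub_cancel, add_sub_cancel_right] at this
      linarith [norm_sub_le x y, hr x hx, hr y hy]
    · have h := finckePohst_sound rows _ [] (List.ofFn k).reverse (by simp [hrows]) hsearch (by
        rw [hform]
        have : (0 : ℤ) < D := by exact_mod_cast hD
        push_cast at hsmall
        gcongr)
      simp only [List.reverse_reverse, List.append_nil, Bool.or_eq_true, List.all_eq_true,
        List.any_eq_true, beq_iff_eq] at h
      rcases h with h | ⟨c, hc, h | h⟩
      · exact absurd (funext fun j => h _ (List.mem_ofFn.2 ⟨j, rfl⟩)) hk
      · obtain rfl := List.ofFn_injective h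
        exact of_cert c hc x hx y hy
      -- One certificate serves both signs because the cell is centrally symmetric.
      · obtain rfl := List.ofFn_injective h
        have := of_cert c hc _ (neg_mem_voronoiCell hx) _ (neg_mem_voronoiCell hy)
        rwa [Matrix.mulVec_neg, map_neg, ← norm_neg, neg_sub', neg_add, neg_neg]
  have hcell : ∀ v ∈ matrixLattice (M * C.map (fun z : ℤ => (z : ℝ))), v ≠ 0 →
      2 * coveringRadius (matrixLattice M) ≤ setDist (voronoiCell (matrixLattice M))
        ((fun x => v + x) '' voronoiCell (matrixLattice M)) := by
    intro v hv hv0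
    rw [matrixLattice_mul_eq] at hv
    obtain ⟨_, ⟨k, rfl⟩, rfl⟩ := hv
    refine le_csInf ⟨_, 0, zero_mem_voronoiCell, _, ⟨0, zero_mem_voronoiCell, rfl⟩, rfl⟩ ?_
    rintro _ ⟨x, hx, _, ⟨y, hy, rfl⟩, rfl⟩
    rw [dist_comm, dist_eq_norm]
    have hk : k ≠ 0 := by
      rintro rfl
      simp at hv0
    refine le_trans ?_ (hsep k hk x hx y hy)
    linarith [coveringRadius_le hcov']
  have hscheme : IsSublatticeColoringScheme (matrixLattice M)
      (matrixLattice (M * C.map (fun z : ℤ => (z : ℝ)))) n N :=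
    { rank_eq := hrank
      le := hle
      index_eq := by
        rw [relIndex_matrixLattice_mul hP (by rintro h; simp [h] at hC; omega), hC]
      cell_dist := hcell
      avoids := sublatticeColoringAvoids_of_cell_dist hcov' hpos hcell }
  exact ⟨hscheme, chiEuclidean_le_of_isSublatticeColoringScheme hfin hn hN hpos hscheme⟩

end Certificates

/-! ### The lattice (n + 1) A_n* and its covering radius. -/

section RootLatticeA

variable {n : ℕ}

lemma genA_castSucc (i j : Fin n) : genA n i.castSucc j = if i = j then -(n : ℝ) else 1 := by
  simp [genA]

lemma genA_last (j : Fin n) : genA n (Fin.last n) j = 1 := by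
  simp [genA, (Fin.castSucc_lt_last j).ne']

lemma latticePoint_genA_castSucc (k : Fin n → ℤ) (i : Fin n) :
    latticePoint (genA n) k i.castSucc = ∑ j, (k j : ℝ) - (n + 1) * k i := by
  have : ∀ j, genA n i.castSucc j * (k j : ℝ) =
      (k j : ℝ) - if j = i then (n + 1) * (k j : ℝ) else 0 := by
    intro j
    rw [genA_castSucc]
    rcases eq_or_ne i j with rfl | h
    · simp only [if_true]; ring
    · simp [h, h.symm]
  rw [latticePoint_apply, Finset.sum_congr rfl fun j _ => this j, Finset.sum_sub_distrib]
  simp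

lemma latticePoint_genA_last (k : Fin n → ℤ) :
    latticePoint (genA n) k (Fin.last n) = ∑ j, (k j : ℝ) := by
  simp [latticePoint_apply, genA_last]

lemma sum_latticePoint_genA (k : Fin n → ℤ) : ∑ i, latticePoint (genA n) k i = 0 := by
  rw [Fin.sum_univ_castSucc, latticePoint_genA_last]
  simp only [latticePoint_genA_castSucc, Finset.sum_sub_distrib, ← Finset.mul_sum]
  simp
  ring

lemma sum_eq_zero_of_mem_latticeSpan_genA {x : EuclideanSpace ℝ (Fin (n + 1))}
    (hx : x ∈ latticeSpan (matrixLattice (genA n))) : ∑ i, x i = 0 := by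
  induction hx using Submodule.span_induction with
  | mem x h => obtain ⟨k, rfl⟩ := h; exact sum_latticePoint_genA k
  | zero => simp
  | add x y _ _ hx hy => simp [Finset.sum_add_distrib, hx, hy]
  | smul a x _ hx => simp [← Finset.mul_sum, hx]

/-- A vector of coordinate sum zero lies in the span of a lattice containing the differences of
the standard basis vectors from the last one. -/
lemma mem_latticeSpan_of_sum_eq_zero {L : AddSubgroup (EuclideanSpace ℝ (Fin (n + 1)))}
    (hL : ∀ i : Fin n, EuclideanSpace.single i.castSucc (1 : ℝ) -
      EuclideanSpace.single (Fin.last n) 1 ∈ L)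
    {x : EuclideanSpace ℝ (Fin (n + 1))} (hx : ∑ i, x i = 0) : x ∈ latticeSpan L := by
  have : x = ∑ i : Fin n, x i.castSucc • (EuclideanSpace.single i.castSucc (1 : ℝ) -
      EuclideanSpace.single (Fin.last n) 1) := by
    rw [Fin.sum_univ_castSucc] at hx
    ext j
    induction j using Fin.lastCases with
    | last => simp [(Fin.castSucc_lt_last _).ne', Finset.sum_neg_distrib]; linarith
    | cast j => simp [Pi.single_apply]
  rw [this]
  exact Submodule.sum_mem _ fun i _ => Submodule.smul_mem _ _ (mem_latticeSpan (hL i))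

lemma single_sub_single_last_mem_rootLatticeA (i : Fin n) :
    EuclideanSpace.single i.castSucc (1 : ℝ) - EuclideanSpace.single (Fin.last n) 1 ∈
      rootLatticeA n := by
  refine ⟨fun j => ⟨(if j = i.castSucc then 1 else 0) - (if j = Fin.last n then 1 else 0), ?_⟩, ?_⟩
  · simp
  · simp [Finset.sum_sub_distrib]

theorem matrixLattice_genA_eq :
    matrixLattice (genA n) = ((n : ℝ) + 1) • dualLattice (rootLatticeA n) := by
  have hn : (n : ℝ) + 1 ≠ 0 := by positivity
  ext x
  rw [AddSubgroup.mem_smul_pointwise_iff_exists]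
  constructor
  · rintro ⟨k, rfl⟩
    change ∃ s ∈ _, ((n : ℝ) + 1) • s = latticePoint (genA n) k
    refine ⟨((n : ℝ) + 1)⁻¹ • latticePoint (genA n) k, ⟨Submodule.smul_mem _ _
      (mem_latticeSpan_of_sum_eq_zero single_sub_single_last_mem_rootLatticeA
        (sum_latticePoint_genA k)), ?_⟩, smul_inv_smul₀ hn _⟩
    rintro z ⟨hz, hz0⟩
    choose a ha using hz
    -- Column j of `genA n` is the all-ones vector minus (n + 1) e_j, and the all-ones part pairs to
    -- zero with z.
    refine ⟨-∑ i : Fin n, k i * a i.castSucc, ?_⟩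
    rw [inner_smul_left, PiLp.inner_apply]
    rw [Fin.sum_univ_castSucc] at hz0 ⊢
    simp only [latticePoint_genA_castSucc, latticePoint_genA_last, RCLike.inner_apply, conj_trivial,
      mul_sub, Finset.sum_sub_distrib, ← Finset.sum_mul]
    rw [add_comm, ← eq_sub_iff_add_eq, zero_sub] at hz0
    rw [hz0]
    push_cast
    simp only [ha]
    have : ∀ i : Fin n, (a i.castSucc : ℝ) * ((n + 1) * k i) =
      (n + 1) * (k i * a i.castSucc) := fun i => by ring
    simp only [this, ← Finset.mul_sum]
    field_simp
    ring
  · rintro ⟨y, ⟨hyX, hy⟩, rfl⟩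
    have hy0 : ∑ i, y i = 0 := by
      have : latticeSpan (rootLatticeA n) ≤ LinearMap.ker
          (∑ i, (EuclideanSpace.proj i : EuclideanSpace ℝ (Fin (n + 1)) →L[ℝ] ℝ)).toLinearMap := by
        refine Submodule.span_le.2 fun z hz => ?_
        simpa using hz.2
      simpa using this hyX
    choose k hk using fun i => hy _ (single_sub_single_last_mem_rootLatticeA i)
    simp only [inner_sub_right, EuclideanSpace.inner_single_right, conj_trivial, one_mul] at hk
    have hlast : (n + 1) * y (Fin.last n) = -∑ i, (k i : ℝ) := by
      rw [Fin.sum_univ_castSucc] at hy0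
      simp only [← hk, Finset.sum_sub_distrib]
      simp
      linarith
    refine ⟨-k, ?_⟩
    change _ = latticePoint (genA n) (-k)
    ext j
    induction j using Fin.lastCases with
    | last => simp [latticePoint_genA_last, hlast]
    | cast j =>
      rw [latticePoint_genA_castSucc]
      simp only [PiLp.smul_apply, smul_eq_mul, Pi.neg_apply, Int.cast_neg, Finset.sum_neg_distrib]
      rw [← hlast, ← hk]
      ring

/-- Abel summation: a monotone sequence pairs nonnegatively with a sequence whose tails are
nonnegative, after subtraction of the first term. -/
lemma sum_sub_mul_nonneg {y g : Fin (n + 1) → ℝ} (hy : Monotone y)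
    (hg : ∀ j, 0 ≤ ∑ i ∈ Finset.Ici j, g i) : 0 ≤ ∑ i, (y i - y 0) * g i := by
  induction n with
  | zero => simp
  | succ n ih =>
    have htail : ∀ j : Fin (n + 1), ∑ i ∈ Finset.Ici j.succ, g i =
        ∑ i ∈ Finset.Ici j, g i.succ := by
      intro j
      rw [← Fin.map_succEmb_Ici, Finset.sum_map]
      rfl
    have h1 := ih (y := fun i => y i.succ) (g := fun i => g i.succ)
      (fun i j hij => hy (Fin.succ_le_succ_iff.2 hij)) fun j => htail j ▸ hg j.succ
    have h2 := htail 0 ▸ hg (Fin.succ 0)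
    have h3 : Finset.Ici (0 : Fin (n + 1)) = Finset.univ := by ext; simp
    rw [h3] at h2
    have h4 : 0 ≤ y (Fin.succ 0) - y 0 := sub_nonneg.2 (hy (Fin.zero_le _))
    rw [Fin.sum_univ_succ, sub_self, zero_mul, zero_add]
    calc (0 : ℝ) ≤ ∑ i : Fin (n + 1), (y i.succ - y (Fin.succ 0)) * g i.succ +
          (y (Fin.succ 0) - y 0) * ∑ i : Fin (n + 1), g i.succ := by positivity
      _ = _ := by
        rw [Finset.mul_sum, ← Finset.sum_add_distrib]
        exact Finset.sum_congr rfl fun i _ => by ring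

/-- The vector of `(n + 1) A_n*` attached to a set of coordinates. -/
def subsetVector (S : Finset (Fin (n + 1))) : EuclideanSpace ℝ (Fin (n + 1)) :=
  WithLp.toLp 2 fun i => (if i ∈ S then (n : ℝ) + 1 else 0) - S.card

lemma subsetVector_mem (S : Finset (Fin (n + 1))) : subsetVector S ∈ matrixLattice (genA n) := by
  -- The i-th minus the last coordinate of a lattice point is -(n + 1) kᵢ, which determines k.
  refine ⟨fun i => (if Fin.last n ∈ S then 1 else 0) - (if i.castSucc ∈ S then 1 else 0), ?_⟩
  change _ = latticePoint (genA n) _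
  have hcard : (S.card : ℝ) = ∑ i : Fin n, (if i.castSucc ∈ S then (1 : ℝ) else 0) +
      if Fin.last n ∈ S then 1 else 0 := by
    rw [← Fin.sum_univ_castSucc fun i => if i ∈ S then (1 : ℝ) else 0]
    simp
  ext j
  induction j using Fin.lastCases with
  | last =>
    rw [latticePoint_genA_last]
    simp only [subsetVector, hcard, Int.cast_sub, Int.cast_ite, Int.cast_one, Int.cast_zero,
      Finset.sum_sub_distrib, Finset.sum_const, Finset.card_univ, Fintype.card_fin, nsmul_eq_mul]
    split_ifs <;> ring
  | cast j =>
    rw [latticePoint_genA_castSucc]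
    simp only [subsetVector, hcard, Int.cast_sub, Int.cast_ite, Int.cast_one, Int.cast_zero,
      Finset.sum_sub_distrib, Finset.sum_const, Finset.card_univ, Fintype.card_fin, nsmul_eq_mul]
    split_ifs <;> ring

lemma inner_subsetVector (S : Finset (Fin (n + 1))) {x : EuclideanSpace ℝ (Fin (n + 1))}
    (hx : ∑ i, x i = 0) : inner ℝ x (subsetVector S) = (n + 1) * ∑ i ∈ S, x i := by
  simp only [PiLp.inner_apply, subsetVector, RCLike.inner_apply, conj_trivial, sub_mul,
    Finset.sum_sub_distrib, ite_mul, zero_mul, ← Finset.mul_sum, hx]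
  simp [Finset.sum_ite_mem, Finset.mul_sum]

lemma norm_subsetVector_sq (S : Finset (Fin (n + 1))) :
    ‖subsetVector S‖ ^ 2 = (n + 1) * (S.card * (n + 1 - S.card)) := by
  rw [← real_inner_self_eq_norm_sq, inner_subsetVector S
    (sum_eq_zero_of_mem_latticeSpan_genA (mem_latticeSpan (subsetVector_mem S)))]
  congr 1
  rw [Finset.sum_congr rfl fun i hi =>
    show (subsetVector S) i = (n : ℝ) + 1 - S.card by simp [subsetVector, hi]]
  simp only [Finset.sum_const, nsmul_eq_mul]

/-- These are the facet inequalities of the permutohedron, obtained from the vectors `subsetVector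
S`. -/
lemma two_mul_sum_le_of_mem_voronoiCell {x : EuclideanSpace ℝ (Fin (n + 1))}
    (hx : x ∈ voronoiCell (matrixLattice (genA n))) (S : Finset (Fin (n + 1))) :
    2 * ∑ i ∈ S, x i ≤ S.card * (n + 1 - S.card) := by
  have h := inner_le_of_mem_voronoiCell hx (subsetVector_mem S)
  rw [inner_subsetVector S (sum_eq_zero_of_mem_latticeSpan_genA hx.1), norm_subsetVector_sq,
    mul_left_comm] at h
  exact le_of_mul_le_mul_left h (by positivity)

/-- The tails of the Weyl vector i - n/2 attain the permutohedron bound for sets of size n + 1 - j.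
-/
lemma sum_Ici_sub_half (j : Fin (n + 1)) :
    2 * ∑ i ∈ Finset.Ici j, ((i : ℝ) - n / 2) = (n + 1 - j) * j := by
  have hr : ∀ m : ℕ, 2 * ∑ i ∈ Finset.range m, ((i : ℝ) - n / 2) = m * (m - 1 - n) := by
    intro m
    induction m with
    | zero => simp
    | succ m ih => rw [Finset.sum_range_succ, mul_add, ih]; push_cast; ring
  have h1 : ∑ i ∈ Finset.Iio j, ((i : ℝ) - n / 2) =
      ∑ i ∈ Finset.range j, ((i : ℝ) - n / 2) := by
    rw [← Nat.Iio_eq_range, ← Fin.map_valEmbedding_Iio, Finset.sum_map]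
    rfl
  have h2 : ∑ i ∈ Finset.Ici j, ((i : ℝ) - n / 2) + ∑ i ∈ Finset.Iio j, ((i : ℝ) - n / 2) =
      ∑ i : Fin (n + 1), ((i : ℝ) - n / 2) := by
    rw [add_comm, ← Finset.sum_filter_add_sum_filter_not Finset.univ (· < j)]
    congr 2 <;> ext <;> simp
  rw [Fin.sum_univ_eq_sum_range (fun i => (i : ℝ) - n / 2), h1] at h2
  have h3 := hr (n + 1)
  have h4 := hr j
  rw [← h2] at h3
  push_cast at h3
  linarith

lemma sum_sub_half_sq (n : ℕ) :
    ∑ i : Fin (n + 1), ((i : ℝ) - n / 2) ^ 2 = (n : ℝ) * (n + 1) * (n + 2) / 12 := by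
  have hr : ∀ (c : ℝ) (m : ℕ), ∑ i ∈ Finset.range m, ((i : ℝ) - c) ^ 2 =
      m * (m - 1) * (2 * m - 1) / 6 - c * m * (m - 1) + m * c ^ 2 := by
    intro c m
    induction m with
    | zero => simp
    | succ m ih => rw [Finset.sum_range_succ, ih]; push_cast; ring
  rw [Fin.sum_univ_eq_sum_range (fun i => ((i : ℝ) - n / 2) ^ 2), hr]
  push_cast
  ring

/-- The covering radius of `(n + 1) A_n*` is at most the norm of the Weyl vector of `A_n`. -/
theorem norm_sq_le_of_mem_voronoiCell_genA {x : EuclideanSpace ℝ (Fin (n + 1))}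
    (hx : x ∈ voronoiCell (matrixLattice (genA n))) :
    ‖x‖ ^ 2 ≤ n * (n + 1) * (n + 2) / 12 := by
  have hx0 := sum_eq_zero_of_mem_latticeSpan_genA hx.1
  set σ := Tuple.sort x.ofLp
  set y : Fin (n + 1) → ℝ := fun i => x (σ i)
  have hy : Monotone y := Tuple.monotone_sort x.ofLp
  have hy0 : ∑ i, y i = 0 := (Equiv.sum_comp σ x.ofLp).trans hx0
  -- The tails of the sorted point y are dominated by those of the Weyl vector w. Abel summation
  -- then gives ⟨y, w - y⟩ ≥ 0, so |y|² ≤ ⟨y, w⟩ ≤ (|y|² + |w|²)/2.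
  have htail : ∀ j : Fin (n + 1), 0 ≤ ∑ i ∈ Finset.Ici j, ((i : ℝ) - n / 2 - y i) := by
    intro j
    have h := two_mul_sum_le_of_mem_voronoiCell hx ((Finset.Ici j).map σ.toEmbedding)
    rw [Finset.sum_map, Finset.card_map, Fin.card_Ici, Nat.cast_sub j.2.le] at h
    push_cast at h
    have h2 := sum_Ici_sub_half j
    rw [Finset.sum_sub_distrib]
    have h3 : ∑ i ∈ Finset.Ici j, x (σ.toEmbedding i) = ∑ i ∈ Finset.Ici j, y i := rfl
    rw [h3] at h
    linarith
  have h := sum_sub_mul_nonneg hy htail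
  have hsum : ∑ i : Fin (n + 1), ((i : ℝ) - n / 2 - y i) = 0 := by
    have h2 := sum_Ici_sub_half (0 : Fin (n + 1))
    have h3 : Finset.Ici (0 : Fin (n + 1)) = Finset.univ := by ext; simp
    rw [h3] at h2
    rw [Finset.sum_sub_distrib, hy0]
    simpa using h2
  simp only [sub_mul (y _), Finset.sum_sub_distrib (f := fun i => y i * _), ← Finset.mul_sum, hsum,
    mul_zero, sub_zero] at h
  have hsq : ∑ i, (y i * ((i : ℝ) - n / 2 - y i)) ≤
      ∑ i : Fin (n + 1), (((i : ℝ) - n / 2) ^ 2 / 2 - y i ^ 2 / 2) :=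
    Finset.sum_le_sum fun i _ => by nlinarith [sq_nonneg ((i : ℝ) - n / 2 - y i)]
  rw [Finset.sum_sub_distrib, ← Finset.sum_div, ← Finset.sum_div, sum_sub_half_sq] at hsq
  have hnorm : ‖x‖ ^ 2 = ∑ i, y i ^ 2 := by
    rw [EuclideanSpace.real_norm_sq_eq, ← Equiv.sum_comp σ]
  linarith

end RootLatticeA

/-! ### Weyl chambers of E₇ and the circumradius bound √(7/8). -/

section WeylChamber

variable {E : Type*} [NormedAddCommGroup E] [InnerProductSpace ℝ E]

/-- Integral linear combinations of a family of vectors. -/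
def intComb (α : Fin 7 → E) (p : Fin 7 → ℤ) : E := ∑ i, (p i : ℝ) • α i

/-- A system of simple roots of type `E₇` in the lattice `L`, such that the fundamental weight at
the minuscule node (half of the integral combination below) belongs to `L`. -/
structure IsSimpleSystemE7 (L : AddSubgroup E) (α : Fin 7 → E) : Prop where
  mem : ∀ i, α i ∈ L
  inner_eq : ∀ i j, inner ℝ (α i) (α j) = (CartanMatrix.E₇ i j : ℝ)
  weight_mem : (1 / 2 : ℝ) • intComb α ![2, 3, 4, 6, 5, 4, 3] ∈ L

/-- The reflection of a simple system in one of its roots. -/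
def reflectSystem (α : Fin 7 → E) (i : Fin 7) (j : Fin 7) : E :=
  α j - (CartanMatrix.E₇ i j : ℝ) • α i

lemma intComb_reflectSystem (α : Fin 7 → E) (i : Fin 7) (p : Fin 7 → ℤ) :
    intComb (reflectSystem α i) p =
      intComb α p - (CartanMatrix.E₇.mulVec p i : ℝ) • α i := by
  simp only [intComb, reflectSystem, smul_sub, Finset.sum_sub_distrib, smul_smul, ← Finset.sum_smul,
    Matrix.mulVec, dotProduct]
  congr 2
  push_cast
  exact Finset.sum_congr rfl fun j _ => mul_comm _ _

variable {L : AddSubgroup E} {α : Fin 7 → E}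

lemma IsSimpleSystemE7.reflect (h : IsSimpleSystemE7 L α) (i : Fin 7) :
    IsSimpleSystemE7 L (reflectSystem α i) where
  mem j := by
    refine sub_mem (h.mem j) ?_
    rw [Int.cast_smul_eq_zsmul]
    exact zsmul_mem (h.mem i) _
  inner_eq j k := by
    simp only [reflectSystem, inner_sub_left, inner_sub_right, inner_smul_left, inner_smul_right,
      h.inner_eq, CartanMatrix.E₇_isSymm.apply i j, CartanMatrix.E₇_diag, conj_trivial]
    push_cast
    ring
  weight_mem := by
    -- Twice the minuscule weight pairs to 2 with the last simple root and to 0 with the others, so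
    -- a reflection changes the weight by a lattice vector.
    have hw : ∀ i, CartanMatrix.E₇.mulVec ![2, 3, 4, 6, 5, 4, 3] i =
        2 * if i = 6 then 1 else 0 := by
      decide
    rw [intComb_reflectSystem, smul_sub, hw, smul_smul]
    refine sub_mem h.weight_mem ?_
    rw [Int.cast_mul, Int.cast_ofNat, ← mul_assoc, one_div, inv_mul_cancel₀ two_ne_zero, one_mul,
      Int.cast_smul_eq_zsmul]
    exact zsmul_mem (h.mem i) _

lemma span_le_span_reflectSystem (α : Fin 7 → E) (i : Fin 7) :
    Submodule.span ℝ (Set.range α) ≤ Submodule.span ℝ (Set.range (reflectSystem α i)) := by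
  have hi : α i ∈ Submodule.span ℝ (Set.range (reflectSystem α i)) := by
    have : α i = -reflectSystem α i i := by
      simp only [reflectSystem, CartanMatrix.E₇_diag, Int.cast_ofNat, two_smul]
      abel
    rw [this]
    exact neg_mem (Submodule.subset_span ⟨i, rfl⟩)
  refine Submodule.span_le.2 ?_
  rintro _ ⟨j, rfl⟩
  have : α j = reflectSystem α i j + (CartanMatrix.E₇ i j : ℝ) • α i := by simp [reflectSystem]
  rw [this]
  exact add_mem (Submodule.subset_span ⟨j, rfl⟩) (Submodule.smul_mem _ _ hi)

lemma IsSimpleSystemE7.inner_intComb (h : IsSimpleSystemE7 L α) (p q : Fin 7 → ℤ) :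
    inner ℝ (intComb α p) (intComb α q) = (p ⬝ᵥ CartanMatrix.E₇.mulVec q : ℤ) := by
  simp only [intComb, sum_inner, inner_sum, inner_smul_left, inner_smul_right, h.inner_eq,
    conj_trivial, dotProduct, Matrix.mulVec, Finset.mul_sum]
  push_cast
  rw [Finset.sum_comm]
  exact Finset.sum_congr rfl fun i _ => Finset.sum_congr rfl fun j _ => by ring

/-- Every vector of the span of a simple system lies in the closed Weyl chamber of some simple
system. -/
lemma exists_isSimpleSystemE7_nonneg
    (hfin : ∀ r : ℝ, {z ∈ (L : Set E) | ‖z‖ ≤ r}.Finite) (h : IsSimpleSystemE7 L α) {x : E}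
    (hx : x ∈ Submodule.span ℝ (Set.range α)) :
    ∃ β, IsSimpleSystemE7 L β ∧ x ∈ Submodule.span ℝ (Set.range β) ∧ ∀ i, 0 ≤ inner ℝ x (β i) := by
  let T : Set (Fin 7 → E) :=
    {β | IsSimpleSystemE7 L β ∧ x ∈ Submodule.span ℝ (Set.range β)}
  have hT : T.Finite := by
    refine (Set.Finite.pi' fun _ : Fin 7 => hfin 2).subset fun β hβ i => ⟨hβ.1.mem i, ?_⟩
    have := hβ.1.inner_eq i i
    rw [real_inner_self_eq_norm_sq, CartanMatrix.E₇_diag] at this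
    push_cast at this
    nlinarith [norm_nonneg (β i)]
  -- The coefficients are those of 2ρ, the sum of the positive roots. Reflection in βᵢ replaces 2ρ
  -- by 2ρ - 2βᵢ, so maximality of ⟨x, 2ρ⟩ forces ⟨x, βᵢ⟩ ≥ 0.
  obtain ⟨β, hβ, hmax⟩ := Set.exists_max_image T
    (fun β => inner ℝ x (intComb β ![34, 49, 66, 96, 75, 52, 27])) hT ⟨α, h, hx⟩
  refine ⟨β, hβ.1, hβ.2, fun i => ?_⟩
  have hρ : ∀ i, CartanMatrix.E₇.mulVec ![34, 49, 66, 96, 75, 52, 27] i = 2 := by decide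
  have := hmax (reflectSystem β i) ⟨hβ.1.reflect i, span_le_span_reflectSystem β i hβ.2⟩
  simp only [intComb_reflectSystem, inner_sub_right, inner_smul_right, hρ, Int.cast_ofNat] at this
  linarith

/-- Inverting the Cartan matrix expresses c through a ≥ 0. As a polynomial in a, c₀²/8 + c₀c₆ - ∑
cᵢaᵢ has only nonnegative coefficients, and the bounds on c₀ and c₆ give 1/8 + 3/4 = 7/8. -/
lemma chamber_quadratic_le {a c : Fin 7 → ℝ} (ha : ∀ i, 0 ≤ a i)
    (hac : ∀ i, a i = ∑ j, (CartanMatrix.E₇ i j : ℝ) * c j) (h0 : c 0 ≤ 1) (h6 : c 6 ≤ 3 / 4) :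
    ∑ i, c i * a i ≤ 7 / 8 := by
  have e0 := hac 0
  have e1 := hac 1
  have e2 := hac 2
  have e3 := hac 3
  have e4 := hac 4
  have e5 := hac 5
  have e6 := hac 6
  simp [Fin.sum_univ_succ, CartanMatrix.E₇] at e0 e1 e2 e3 e4 e5 e6
  have c0 : c 0 = (4 * a 0 + 4 * a 1 + 6 * a 2 + 8 * a 3 + 6 * a 4 + 4 * a 5 + 2 * a 6) / 2 :=
    by linarith
  have c1 : c 1 = (4 * a 0 + 7 * a 1 + 8 * a 2 + 12 * a 3 + 9 * a 4 + 6 * a 5 + 3 * a 6) / 2 :=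
    by linarith
  have c2 : c 2 = (6 * a 0 + 8 * a 1 + 12 * a 2 + 16 * a 3 + 12 * a 4 + 8 * a 5 + 4 * a 6) / 2
    := by linarith
  have c3 : c 3 = (8 * a 0 + 12 * a 1 + 16 * a 2 + 24 * a 3 + 18 * a 4 + 12 * a 5 + 6 * a 6) / 2
    := by linarith
  have c4 : c 4 = (6 * a 0 + 9 * a 1 + 12 * a 2 + 18 * a 3 + 15 * a 4 + 10 * a 5 + 5 * a 6) / 2
    := by linarith
  have c5 : c 5 = (4 * a 0 + 6 * a 1 + 8 * a 2 + 12 * a 3 + 10 * a 4 + 8 * a 5 + 4 * a 6) / 2 :=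
    by linarith
  have c6 : c 6 = (2 * a 0 + 3 * a 1 + 4 * a 2 + 6 * a 3 + 5 * a 4 + 4 * a 5 + 3 * a 6) / 2 :=
    by linarith
  have hA := mul_nonneg (sub_nonneg.2 h0) (sub_nonneg.2 h6)
  have hc0 : 0 ≤ c 0 := by linarith [ha 0, ha 1, ha 2, ha 3, ha 4, ha 5, ha 6]
  have hbound : c 0 ^ 2 / 8 + c 0 * c 6 ≤ 7 / 8 := by nlinarith
  refine le_trans ?_ hbound
  simp only [Fin.sum_univ_seven]
  rw [c0, c1, c2, c3, c4, c5, c6]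
  have hp : ∀ i j, 0 ≤ a i * a j := fun i j => mul_nonneg (ha i) (ha j)
  linarith [hp 0 0, hp 0 1, hp 0 2, hp 0 3, hp 0 4, hp 0 5, hp 0 6, hp 1 1, hp 1 2, hp 1 3, hp 1
    4, hp 1 5, hp 1 6, hp 2 2, hp 2 3, hp 2 4, hp 2 5, hp 2 6, hp 3 3, hp 3 4, hp 3 5, hp 3 6, hp 4
    4, hp 4 5, hp 4 6, hp 5 5, hp 5 6, hp 6 6]

/-- The Voronoi cell of a lattice containing the simple roots of `E₇` and the minuscule weight has
circumradius at most `√(7/8)` on their span. -/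
theorem norm_sq_le_of_isSimpleSystemE7
    (hfin : ∀ r : ℝ, {z ∈ (L : Set E) | ‖z‖ ≤ r}.Finite) (h : IsSimpleSystemE7 L α) {x : E}
    (hx : x ∈ voronoiCell L) (hxα : x ∈ Submodule.span ℝ (Set.range α)) : ‖x‖ ^ 2 ≤ 7 / 8 := by
  obtain ⟨β, hβ, hxβ, ha⟩ := exists_isSimpleSystemE7_nonneg hfin h hxα
  obtain ⟨c, rfl⟩ := (Submodule.mem_span_range_iff_exists_fun ℝ).1 hxβ
  have hself : ∀ w, inner ℝ w (∑ i, c i • β i) = ∑ i, c i * inner ℝ w (β i) := fun w => by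
    simp only [inner_sum, inner_smul_right]
  set x := ∑ i, c i • β i
  have hxi : ∀ i, inner ℝ x (β i) = ∑ j, (CartanMatrix.E₇ i j : ℝ) * c j := by
    intro i
    simp only [x, sum_inner, inner_smul_left, conj_trivial]
    refine Finset.sum_congr rfl fun j _ => ?_
    rw [real_inner_comm, hβ.inner_eq, mul_comm]
  have hcomb : ∀ p, inner ℝ x (intComb β p) = ∑ j, (CartanMatrix.E₇.mulVec p j : ℝ) * c j := by
    intro p
    simp only [intComb, inner_sum, inner_smul_right, hxi, dotProduct, Matrix.mulVec]
    push_cast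
    simp only [Finset.sum_mul, Finset.mul_sum]
    rw [Finset.sum_comm]
    refine Finset.sum_congr rfl fun i _ => Finset.sum_congr rfl fun j _ => ?_
    rw [← CartanMatrix.E₇_isSymm.apply]
    ring
  -- This is the highest root; it is also the fundamental weight at node 0, so its inner product
  -- with x is c₀.
  have hroot : intComb β ![2, 2, 3, 4, 3, 2, 1] ∈ L := by
    refine sum_mem fun i _ => ?_
    rw [Int.cast_smul_eq_zsmul]
    exact zsmul_mem (hβ.mem i) _
  have h0 : c 0 ≤ 1 := by
    have h1 := inner_le_of_mem_voronoiCell hx hroot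
    rw [← real_inner_self_eq_norm_sq, hβ.inner_intComb, hcomb,
      show CartanMatrix.E₇.mulVec ![2, 2, 3, 4, 3, 2, 1] = Pi.single 0 1 by decide,
      show ![2, 2, 3, 4, 3, 2, 1] ⬝ᵥ (Pi.single 0 1 : Fin 7 → ℤ) = 2 by decide] at h1
    simp [Pi.single_apply] at h1
    linarith
  -- The minuscule weight pairs with x to c₆ and has squared norm 3/2.
  have h6 : c 6 ≤ 3 / 4 := by
    have h1 := inner_le_of_mem_voronoiCell hx hβ.weight_mem
    rw [← real_inner_self_eq_norm_sq, inner_smul_left, inner_smul_right, inner_smul_right,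
      hβ.inner_intComb, hcomb,
      show CartanMatrix.E₇.mulVec ![2, 3, 4, 6, 5, 4, 3] = Pi.single 6 2 by decide,
      show ![2, 3, 4, 6, 5, 4, 3] ⬝ᵥ (Pi.single 6 2 : Fin 7 → ℤ) = 6 by decide] at h1
    simp [Pi.single_apply] at h1
    linarith
  rw [← real_inner_self_eq_norm_sq, hself]
  exact chamber_quadratic_le ha hxi h0 h6

end WeylChamber

/-! ### The lattice E₇* in coordinates: Gram matrix, simple roots, covering radius. -/

section RootLatticeE7

/-- Coordinates with respect to the basis `genE7` of `E_7*`. -/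
def coordE7 : Matrix (Fin 7) (Fin 8) ℝ :=
  !![0, 1, 1, 1, 1, 1, 1, -2;
     0, 0, 1, 1, 1, 1, 1, -5;
     0, 0, 0, 1, 1, 1, 1, -4;
     0, 0, 0, 0, 1, 1, 1, -3;
     0, 0, 0, 0, 0, 1, 1, -2;
     0, 0, 0, 0, 0, 0, 1, -1;
     0, 0, 0, 0, 0, 0, 0, 4]

lemma coordE7_mul_genE7 : coordE7 * genE7 = 1 := by
  ext i j
  fin_cases i <;> fin_cases j <;>
    simp [coordE7, genE7, Matrix.mul_apply, Fin.sum_univ_succ] <;> norm_num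

/-- Twice the Gram matrix of `E_7*` with respect to the basis `genE7`. -/
def gramE7 : Matrix (Fin 7) (Fin 7) ℤ :=
  !![ 4, -2,  0,  0,  0,  0, 0;
     -2,  4, -2,  0,  0,  0, 2;
      0, -2,  4, -2,  0,  0, 0;
      0,  0, -2,  4, -2,  0, 0;
      0,  0,  0, -2,  4, -2, 0;
      0,  0,  0,  0, -2,  4, 0;
      0,  2,  0,  0,  0,  0, 3]

lemma two_smul_gram_genE7 : ((2 : ℕ) : ℝ) • (genE7.transpose * genE7) =
    gramE7.map (fun z : ℤ => (z : ℝ)) := by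
  ext i j
  fin_cases i <;> fin_cases j <;>
    simp [gramE7, genE7, Matrix.mul_apply, Fin.sum_univ_succ] <;> norm_num

/-- Simple roots of `E₇`, in coordinates. -/
def simpleRootsE7 : Fin 7 → Fin 7 → ℤ :=
  ![![-1, 0, 0, 0, 0, 0, 0], ![2, 4, 4, 3, 2, 1, -2], ![0, -1, 0, 0, 0, 0, 0],
    ![0, 0, -1, 0, 0, 0, 0], ![0, 0, 0, -1, 0, 0, 0], ![0, 0, 0, 0, -1, 0, 0],
    ![0, 0, 0, 0, 0, -1, 0]]

lemma isSimpleSystemE7_simpleRootsE7 :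
    IsSimpleSystemE7 (matrixLattice genE7) fun i => latticePoint genE7 (simpleRootsE7 i) where
  mem i := latticePoint_mem _
  inner_eq i j := by
    have h := inner_latticePoint two_smul_gram_genE7 (simpleRootsE7 i) (simpleRootsE7 j)
    have h2 : ∀ i j, simpleRootsE7 i ⬝ᵥ gramE7.mulVec (simpleRootsE7 j) =
        2 * CartanMatrix.E₇ i j := by
      decide +kernel
    rw [h2] at h
    push_cast at h
    linarith
  weight_mem := by
    have h : intComb (fun i => latticePoint genE7 (simpleRootsE7 i)) ![2, 3, 4, 6, 5, 4, 3] =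
        (2 : ℝ) • latticePoint genE7 ![2, 4, 3, 2, 1, 0, -3] := by
      simp only [intComb, Int.cast_smul_eq_zsmul, ← map_zsmul, ← map_sum]
      rw [two_smul, ← map_add]
      congr 1
      decide +kernel
    rw [h, smul_smul]
    norm_num
    exact latticePoint_mem _

lemma mem_span_simpleRootsE7 {x : EuclideanSpace ℝ (Fin 8)}
    (hx : x ∈ latticeSpan (matrixLattice genE7)) :
    x ∈ Submodule.span ℝ (Set.range fun i => latticePoint genE7 (simpleRootsE7 i)) := by
  refine Submodule.span_le.2 ?_ hx
  rintro _ ⟨k, rfl⟩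
  change latticePoint genE7 k ∈ _
  -- T is twice the inverse of the matrix of simple roots; the factor 2 clears denominators, the
  -- root lattice having index 2 in E₇*.
  let T : Matrix (Fin 7) (Fin 7) ℤ :=
    !![-2,  0,  0,  0,  0,  0,  0;
        0,  0, -2,  0,  0,  0,  0;
        0,  0,  0, -2,  0,  0,  0;
        0,  0,  0,  0, -2,  0,  0;
        0,  0,  0,  0,  0, -2,  0;
        0,  0,  0,  0,  0,  0, -2;
       -2, -1, -4, -4, -3, -2, -1]
  have hT : T * Matrix.of simpleRootsE7 = (2 : ℤ) • 1 := by decide +kernel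
  have h2 : (2 : ℕ) • k = ∑ i, Matrix.vecMul k T i • simpleRootsE7 i := by
    have h3 := congrArg (fun A => Matrix.vecMul k A) hT
    simp only [← Matrix.vecMul_vecMul, Matrix.vecMul_smul, Matrix.vecMul_one] at h3
    rw [← natCast_zsmul, Nat.cast_ofNat, ← h3]
    ext j
    simp only [Finset.sum_apply, Pi.smul_apply, smul_eq_mul]
    rfl
  have h4 : latticePoint genE7 k =
      (1 / 2 : ℝ) •
        ∑ i, ((Matrix.vecMul k T i : ℤ) : ℝ) • latticePoint genE7 (simpleRootsE7 i) := by
    simp only [Int.cast_smul_eq_zsmul, ← map_zsmul, ← map_sum]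
    rw [← h2, map_nsmul, ← Nat.cast_smul_eq_nsmul ℝ, smul_smul]
    norm_num
  rw [h4]
  exact Submodule.smul_mem _ _ (Submodule.sum_mem _ fun i _ =>
    Submodule.smul_mem _ _ (Submodule.subset_span ⟨i, rfl⟩))

/-- The covering radius of `E_7*` is at most `√(7/8)`. -/
theorem norm_sq_le_of_mem_voronoiCell_genE7 {x : EuclideanSpace ℝ (Fin 8)}
    (hx : x ∈ voronoiCell (matrixLattice genE7)) : ‖x‖ ^ 2 ≤ 7 / 8 :=
  norm_sq_le_of_isSimpleSystemE7 (finite_matrixLattice_inter_ball coordE7_mul_genE7)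
    isSimpleSystemE7_simpleRootsE7 hx (mem_span_simpleRootsE7 hx.1)

end RootLatticeE7

/-! ### The generator matrix spans the dual of E₇. -/

section DualE7

lemma latticePoint_genE7 (k : Fin 7 → ℤ) : latticePoint genE7 k =
    !₂[-(k 0 : ℝ) - 3 / 4 * k 6, k 0 - k 1 - 3 / 4 * k 6, k 1 - k 2 + 1 / 4 * k 6,
      k 2 - k 3 + 1 / 4 * k 6, k 3 - k 4 + 1 / 4 * k 6, k 4 - k 5 + 1 / 4 * k 6,
      k 5 + 1 / 4 * k 6, 1 / 4 * k 6] := by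
  ext i
  rw [latticePoint_apply, Fin.sum_univ_seven]
  fin_cases i <;> simp [genE7] <;> ring

lemma single_sub_single_last_mem_rootLatticeE7 (i : Fin 7) :
    EuclideanSpace.single i.castSucc (1 : ℝ) - EuclideanSpace.single (Fin.last 7) 1 ∈
      rootLatticeE7 := by
  refine ⟨⟨0, fun j =>
    ⟨(if j = i.castSucc then 1 else 0) - (if j = Fin.last 7 then 1 else 0), ?_⟩⟩, ?_⟩
  · simp
  · simp [Finset.sum_sub_distrib]

lemma half_vector_mem_rootLatticeE7 :
    !₂[(1 : ℝ) / 2, 1 / 2, 1 / 2, 1 / 2, -1 / 2, -1 / 2, -1 / 2, -1 / 2] ∈ rootLatticeE7 := by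
  refine ⟨⟨1, fun j => ⟨if j < 4 then 0 else -1, ?_⟩⟩, ?_⟩
  · fin_cases j <;> simp <;> norm_num
  · simp [Fin.sum_univ_succ]
    norm_num

theorem matrixLattice_genE7_eq : matrixLattice genE7 = dualLattice rootLatticeE7 := by
  ext x
  constructor
  · rintro ⟨k, rfl⟩
    change latticePoint genE7 k ∈ _
    rw [latticePoint_genE7]
    refine ⟨mem_latticeSpan_of_sum_eq_zero single_sub_single_last_mem_rootLatticeE7 ?_, ?_⟩
    · simp [Fin.sum_univ_succ]
      ring
    · rintro z ⟨⟨e, hz⟩, hz0⟩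
      choose a ha using hz
      -- The first six columns are differences of adjacent basis vectors. The last pairs with z to
      -- -(z₀ + z₁), because z has sum zero; this produces the term with e.
      refine ⟨k 0 * (a 1 - a 0) + k 1 * (a 2 - a 1) + k 2 * (a 3 - a 2) + k 3 * (a 4 - a 3) +
        k 4 * (a 5 - a 4) + k 5 * (a 6 - a 5) - k 6 * (a 0 + a 1 + e), ?_⟩
      have hz7 : z 7 = -(z 0 + z 1 + z 2 + z 3 + z 4 + z 5 + z 6) := by
        rw [Fin.sum_univ_eight] at hz0
        linarith
      simp only [PiLp.inner_apply, RCLike.inner_apply, conj_trivial, Fin.sum_univ_eight, hz7]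
      simp [ha]
      ring
  · rintro ⟨hxX, hx⟩
    have hx0 : ∑ i, x i = 0 := by
      have : latticeSpan rootLatticeE7 ≤ LinearMap.ker
          (∑ i, (EuclideanSpace.proj i : EuclideanSpace ℝ (Fin 8) →L[ℝ] ℝ)).toLinearMap := by
        refine Submodule.span_le.2 fun z hz => ?_
        simpa using hz.2
      simpa using this hxX
    choose d hd using fun i => hx _ (single_sub_single_last_mem_rootLatticeE7 i)
    simp only [inner_sub_right, EuclideanSpace.inner_single_right, conj_trivial, one_mul] at hd
    obtain ⟨h, hh⟩ := hx _ half_vector_mem_rootLatticeE7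
    simp only [PiLp.inner_apply, RCLike.inner_apply, conj_trivial, Fin.sum_univ_eight] at hh
    simp at hh
    rw [Fin.sum_univ_eight] at hx0
    have d0 : x 0 - x 7 = d 0 := hd 0
    have d1 : x 1 - x 7 = d 1 := hd 1
    have d2 : x 2 - x 7 = d 2 := hd 2
    have d3 : x 3 - x 7 = d 3 := hd 3
    have d4 : x 4 - x 7 = d 4 := hd 4
    have d5 : x 5 - x 7 = d 5 := hd 5
    have d6 : x 6 - x 7 = d 6 := hd 6
    -- As x has sum zero, its pairing with the half vector is x₀ + x₁ + x₂ + x₃ = d₀ + d₁ + d₂ + d₃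
    -- + 4x₇.
    obtain ⟨q, hq⟩ : ∃ q : ℤ, 4 * x 7 = q := by
      refine ⟨h - (d 0 + d 1 + d 2 + d 3), ?_⟩
      push_cast
      linarith
    refine ⟨![d 1 + d 2 + d 3 + d 4 + d 5 + d 6 + q, d 2 + d 3 + d 4 + d 5 + d 6,
      d 3 + d 4 + d 5 + d 6, d 4 + d 5 + d 6, d 5 + d 6, d 6, q], ?_⟩
    change _ = latticePoint genE7 _
    rw [latticePoint_genE7]
    ext i
    fin_cases i <;> simp <;> linarith

end DualE7

/-! ### Left inverse and Gram matrix for (n + 1) A_n*. -/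

section GramA

variable {n : ℕ}

/-- Coordinates with respect to the basis `genA n` of `(n + 1) A_n*`. -/
noncomputable def coordA (n : ℕ) : Matrix (Fin n) (Fin (n + 1)) ℝ :=
  Matrix.of fun i j =>
    ((if j = Fin.last n then 1 else 0) - if j = i.castSucc then 1 else 0) / (n + 1)

lemma coordA_mul_genA : coordA n * genA n = 1 := by
  have hn : (n : ℝ) + 1 ≠ 0 := by positivity
  ext i j
  have h : (coordA n * genA n) i j = (genA n (Fin.last n) j - genA n i.castSucc j) / (n + 1) := by
    simp [Matrix.mul_apply, coordA, div_mul_eq_mul_div, sub_mul, ← Finset.sum_div,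
      Finset.sum_sub_distrib]
  rw [h, genA_last, genA_castSucc, Matrix.one_apply]
  split_ifs
  · field_simp
    ring
  · simp

/-- The Gram matrix of `(n + 1) A_n*` with respect to the basis `genA n`. -/
def gramA (n : ℕ) : Matrix (Fin n) (Fin n) ℤ :=
  Matrix.of fun i j => if i = j then (n : ℤ) * (n + 1) else -(n + 1)

lemma gram_genA : ((1 : ℕ) : ℝ) • ((genA n).transpose * genA n) =
    (gramA n).map (fun z : ℤ => (z : ℝ)) := by
  have h : ∀ i j l : Fin n, genA n l.castSucc i * genA n l.castSucc j =
      1 - (if l = i then (n : ℝ) + 1 else 0) - (if l = j then (n : ℝ) + 1 else 0) +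
        if l = i then (if i = j then ((n : ℝ) + 1) ^ 2 else 0) else 0 := by
    intro i j l
    rw [genA_castSucc, genA_castSucc]
    split_ifs <;> first | (subst_vars; simp_all; done) | ring
  ext i j
  rw [Nat.cast_one, one_smul, Matrix.mul_apply, Fin.sum_univ_castSucc]
  simp only [Matrix.transpose_apply, h, Finset.sum_add_distrib, Finset.sum_sub_distrib, genA_last]
  simp only [Finset.sum_const, Finset.card_univ, Fintype.card_fin, Finset.sum_ite_eq',
    Finset.mem_univ, if_true, gramA, Matrix.map_apply, Matrix.of_apply]
  split_ifs <;> push_cast <;> simp <;> ring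

end GramA

/-! ### Quadratic form decompositions and separation certificates. -/

section Data

/-- The form of the sublattice `matC5`, times `2344045`, as a weighted sum of squares. -/
def rowsC5 : List (ℕ × ℕ × List ℤ) :=
  [(270963000, 1, []),
    (6120, 218, [-161]),
    (7630, 253, [-156, -161]),
    (55154, 102, [-11, -42, 7]),
    (2812854, 15, [1, 7, -1, 1])]

/-- Short vectors of the sublattice `matC5` up to sign, with separating directions. -/
def certsC5 : List ((Fin 5 → ℤ) × List (ℕ × (Fin 5 → ℤ))) :=
  [(![1, -1, -1, -1, -1],
      [(2, ![0, -1, 0, 0, 0]), (7, ![0, 0, 1, 0, 1])]),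
    (![1, 0, -1, -1, -1],
      [(1, ![1, 0, 1, 0, 0]), (10, ![0, 0, 1, 0, 0])]),
    (![1, 0, -1, 0, -1],
      [(2, ![0, -1, 0, 0, 0]), (7, ![0, 0, 1, 1, 0])]),
    (![1, 0, 0, 0, 0],
      [(2, ![0, -1, 0, 0, 0]), (7, ![-1, -1, 0, -1, -1])]),
    (![0, 1, 0, 0, 0],
      [(9, ![0, 0, 0, 0, -1]), (1, ![1, 1, 1, 0, 0])]),
    (![0, 0, 1, 0, 0],
      [(7, ![-1, 0, 0, -1, 0]), (2, ![0, 0, 1, 0, 0])]),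
    (![0, 0, 0, 1, 0],
      [(1, ![-1, -1, -1, 0, 0]), (9, ![0, 0, 0, 1, 0])]),
    (![0, 0, 1, 1, 0],
      [(10, ![-1, 0, 0, 0, 0]), (1, ![-1, -1, 0, 0, 0])]),
    (![0, 1, 1, 1, 0],
      [(7, ![-1, 0, 0, 0, -1]), (2, ![0, 0, 1, 0, 0])]),
    (![0, 0, 0, 0, 1],
      [(2, ![0, 0, -1, 0, 0]), (7, ![0, -1, -1, -1, -1])]),
    (![0, 0, 1, 1, 1],
      [(1, ![-1, -1, -1, 0, 0]), (9, ![-1, -1, -1, -1, -1])])]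

/-- The form of the sublattice `matC7`, times `457470`, as a weighted sum of squares. -/
def rowsC7 : List (ℕ × ℕ × List ℤ) :=
  [(3941280, 1, []),
    (27370, 13, [-5]),
    (15470, 18, [-5, 13]),
    (13923, 23, [-10, -10, 3]),
    (18837, 20, [3, 10, 10, 3]),
    (31395, 17, [-7, 10, 5, 5, -7]),
    (76245, 12, [-5, -5, 2, -5, -5, -5])]

/-- Short vectors of the sublattice `matC7` up to sign, with separating directions. -/
def certsC7 : List ((Fin 7 → ℤ) × List (ℕ × (Fin 7 → ℤ))) :=
  [(![0, 1, 1, -1, 0, -1, -1],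
      [(6, ![0, 1, 1, 1, 0, 0, -1]), (1, ![-1, -1, -1, -1, -1, -1, 0])]),
    (![0, 0, 1, 0, 0, -1, -1],
      [(6, ![0, 0, 0, 0, 0, 0, -1]), (1, ![0, -1, -1, -1, -1, -1, 0])]),
    (![0, 0, 0, 0, 1, -1, -1],
      [(1, ![1, 2, 1, 0, 0, 0, -2]), (6, ![0, 1, 1, 0, 0, 0, -1])]),
    (![0, 1, 1, -1, -1, -1, 0],
      [(6, ![1, 1, 1, 1, 0, 0, -1]), (1, ![0, 0, 0, 0, -1, -1, 0])]),
    (![1, 2, 1, -1, -1, -1, 0],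
      [(1, ![0, 0, 0, -1, -1, -1, 0]), (6, ![-1, -2, -1, -1, -1, -1, 1])]),
    (![0, 1, 0, -1, 0, -1, 0],
      [(1, ![1, 3, 2, 1, 0, 0, -2]), (6, ![1, 2, 2, 1, 0, 0, -1])]),
    (![1, 1, 1, -1, 0, -1, 0],
      [(1, ![0, 0, -1, -1, -1, -1, 0]), (6, ![-1, -2, -2, -2, -2, -1, 1])]),
    (![0, 1, 1, 0, 0, -1, 0],
      [(6, ![-1, -2, -1, -1, -1, 0, 1]), (1, ![-3, -6, -5, -4, -3, -1, 4])]),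
    (![0, 1, 0, -1, -1, 0, 0],
      [(1, ![1, 3, 3, 2, 1, 0, -2]), (6, ![1, 2, 2, 2, 1, 0, -1])]),
    (![1, 1, 1, -1, -1, 0, 0],
      [(1, ![0, 0, 0, 0, 0, -1, 0]), (6, ![-1, -2, -2, -1, -1, -1, 1])]),
    (![0, 1, 1, 0, -1, 0, 0],
      [(6, ![-1, -2, -1, 0, 0, 0, 1]), (1, ![-3, -6, -4, -3, -2, -1, 4])]),
    (![1, 1, 0, -1, 0, 0, 0],
      [(1, ![1, 3, 2, 1, 1, 0, -2]), (6, ![-1, -1, -1, -1, -1, -1, 1])]),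
    (![1, 0, 0, 0, 0, 0, 0],
      [(1, ![2, 3, 2, 1, 1, 0, -2]), (6, ![-1, -2, -2, -2, -1, -1, 1])]),
    (![0, 1, 0, 0, 0, 0, 0],
      [(6, ![-1, -1, 0, 0, 0, 0, 1]), (1, ![-2, -3, -2, -2, -1, 0, 2])]),
    (![0, 0, 1, 0, 0, 0, 0],
      [(6, ![-1, -2, -2, -1, -1, 0, 1]), (1, ![-3, -6, -5, -3, -2, -1, 4])]),
    (![1, 1, 1, 0, 0, 0, 0],
      [(6, ![-3, -5, -4, -3, -2, -1, 3]), (1, ![-3, -6, -5, -4, -2, -1, 4])]),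
    (![0, 0, 0, 1, 0, 0, 0],
      [(6, ![-1, -2, -1, -1, 0, 0, 1]), (1, ![-1, -3, -2, -2, -1, 0, 2])]),
    (![0, 0, 0, 0, 1, 0, 0],
      [(6, ![-1, -1, -1, -1, -1, 0, 1]), (1, ![-2, -3, -3, -2, -1, 0, 2])]),
    (![0, 0, 0, 0, 0, 1, 0],
      [(6, ![-1, -1, -1, 0, 0, 0, 1]), (1, ![-2, -3, -2, -1, 0, 0, 2])]),
    (![1, 1, 0, -1, -1, 0, 1],
      [(1, ![2, 4, 3, 2, 1, 0, -2]), (6, ![0, -1, -1, -1, -1, -1, 1])]),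
    (![1, 2, 1, -1, -1, 0, 1],
      [(6, ![-2, -4, -3, -2, -2, -1, 3]), (1, ![-3, -5, -4, -3, -2, -1, 4])]),
    (![0, 1, 0, 0, -1, 0, 1],
      [(6, ![0, -1, 0, 0, 0, 0, 1]), (1, ![-1, -2, -1, -1, -1, 0, 2])]),
    (![1, 1, 1, 0, -1, 0, 1],
      [(6, ![-2, -5, -4, -3, -2, -1, 3]), (1, ![-2, -5, -4, -3, -2, -1, 4])]),
    (![0, 0, 0, 0, 0, 0, 1],
      [(6, ![0, -1, -1, -1, -1, 0, 1]), (1, ![-1, -2, -2, -1, -1, 0, 2])]),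
    (![1, 1, 0, 0, 0, 0, 1],
      [(1, ![-1, -2, -2, -2, -1, 0, 2]), (6, ![-2, -4, -3, -3, -2, -1, 3])]),
    (![1, 1, 0, 0, -1, 1, 1],
      [(1, ![-1, -2, -1, -1, 0, 0, 2]), (6, ![-2, -4, -3, -2, -1, -1, 3])]),
    (![1, 0, 0, 0, 0, 1, 1],
      [(1, ![-1, -2, -2, -1, 0, 0, 2]), (6, ![-2, -4, -4, -3, -2, -1, 3])])]

/-- The form of the sublattice `matC9`, times `1833188789867292`, as a weighted sum of squares. -/
def rowsC9 : List (ℕ × ℕ × List ℤ) :=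
  [(715625040504983400, 1, []),
    (26619337800, 5811, [62]),
    (7316823800, 10666, [-7104, -9423]),
    (459066133240, 1566, [98, 3, -864]),
    (673966466862975, 51, [-13, -25, 6, 6]),
    (23146323104385, 240, [-45, -29, -57, -42, 6]),
    (185170584835080, 99, [-51, -9, -52, 15, -48, 21]),
    (181503840580920, 90, [-11, -11, -9, -12, -15, -8, -9]),
    (181503840580920, 101, [-9, -9, -9, 11, -19, 52, 21, 11])]

/-- Short vectors of the sublattice `matC9` up to sign, with separating directions. -/
def certsC9 : List ((Fin 9 → ℤ) × List (ℕ × (Fin 9 → ℤ))) :=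
  [(![1, -1, -1, -1, -1, -1, -2, -1, -1],
      [(1, ![0, -1, 0, 0, 0, 0, -1, 0, -1]), (23, ![1, 0, 0, 0, 0, 0, 0, 0, 0])]),
    (![1, -1, 0, -1, -1, 0, -2, 0, -1],
      [(11, ![0, 0, -1, -1, -1, -1, 0, -1, -1]), (6, ![1, 0, 0, 0, 0, 0, 0, 0, 0])]),
    (![1, 0, 0, 0, -1, 0, -1, 0, -1],
      [(15, ![0, 0, -1, 0, 0, 0, 0, -1, 0]), (2, ![1, 0, 0, 1, 1, 1, 1, 0, 0])]),
    (![1, 0, 0, 0, 0, 0, -1, 0, -1],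
      [(4, ![0, 0, -1, 0, 0, 0, 0, 0, 0]), (4, ![0, 0, -1, 0, 0, 0, 0, 0, -1]),
        (1, ![1, 1, 0, 1, 1, 1, 1, 1, 0])]),
    (![1, 0, 1, 0, 0, 0, -1, 0, -1],
      [(7, ![0, 0, -1, 0, 0, 0, 0, 0, -1]), (3, ![0, 0, -1, 0, 0, 0, -1, 0, -1]),
        (13, ![-1, -1, -1, -1, -1, -1, -1, -1, -1])]),
    (![0, 0, 1, 0, 0, 0, 0, 1, -1],
      [(13, ![0, 0, -1, 0, 0, 0, 0, 0, 0]), (3, ![-1, 0, -1, -1, -1, -1, -1, -1, 0]),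
        (7, ![-1, 0, -1, -1, -1, -1, -1, -1, -1])]),
    (![1, 0, 0, 0, 0, 0, -1, -1, 0],
      [(4, ![0, 0, 0, 0, 0, 0, 0, 0, -1]), (4, ![0, -1, 0, 0, 0, 0, 0, 0, -1]),
        (1, ![0, -1, 0, 0, 0, 0, -1, 0, -1])]),
    (![1, 0, 0, 0, 0, 1, -1, -1, 0],
      [(7, ![0, -1, 0, 0, 0, 0, 0, 0, -1]), (3, ![0, -1, -1, 0, 0, 0, 0, 0, -1]),
        (13, ![0, 0, 0, 0, 0, 0, 1, 0, 0])]),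
    (![1, 0, 0, 0, -1, 0, -1, 0, 0],
      [(4, ![0, 0, 0, 0, 0, 0, 0, -1, 0]), (4, ![0, 0, 0, 0, 0, 0, 0, -1, -1]),
        (1, ![1, 1, 1, 1, 1, 1, 1, 0, 0])]),
    (![1, 0, 0, 0, 0, 0, -1, 0, 0],
      [(9, ![0, 0, 0, 0, 0, 0, 0, 0, -1]), (1, ![1, 1, 1, 1, 1, 1, 1, 1, 0]),
        (1, ![0, 1, 0, 0, 0, 0, 0, 0, 0])]),
    (![1, 0, 1, 0, 0, 1, -1, 0, 0],
      [(13, ![0, 0, 0, 0, 0, 0, 0, 0, -1]), (3, ![-1, 0, -1, -1, -1, -1, 0, -1, -1]),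
        (7, ![-1, -1, -1, -1, -1, -1, 0, -1, -1])]),
    (![1, 0, 0, 0, 0, 0, 0, 0, 0],
      [(1, ![0, 0, 0, 0, 0, 0, 0, 0, -1]), (1, ![0, 1, 0, 0, 0, 1, 0, 0, 0]),
        (9, ![0, 0, 0, 0, 0, 1, 0, 0, 0])]),
    (![0, 1, 0, 0, 0, 0, 0, 0, 0],
      [(1, ![0, 0, 0, 0, 1, 0, 0, 0, 0])]),
    (![0, 0, 1, 0, 0, 0, 0, 0, 0],
      [(1, ![0, 0, 0, 0, 0, 0, -1, 0, 0]), (1, ![-1, -1, 0, -1, -1, -1, -1, -1, -1]),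
        (9, ![-1, -1, -1, -1, -1, -1, -1, -1, -1])]),
    (![0, 0, 0, 1, 0, 0, 0, 0, 0],
      [(1, ![1, 1, 1, 1, 1, 1, 1, 1, 1]), (1, ![0, 0, 0, 1, 0, 0, 1, 0, 0]),
        (9, ![0, 0, 0, 1, 0, 0, 0, 0, 0])]),
    (![0, 0, 1, 1, 0, 0, 0, 0, 0],
      [(1, ![-1, -1, 0, 0, -1, -1, -1, -1, -1]), (4, ![-1, -1, -1, 0, -1, -1, -1, -1, -1]),
        (4, ![0, 0, 0, 1, 0, 0, 0, 0, 0])]),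
    (![0, 0, 0, 0, 1, 0, 0, 0, 0],
      [(1, ![0, 0, 0, 0, 0, 0, 0, 0, -1]), (1, ![0, 1, 0, 0, 0, 0, 0, 1, 0]),
        (9, ![0, 0, 0, 0, 0, 0, 0, 1, 0])]),
    (![0, 0, 0, 0, 0, 1, 0, 0, 0],
      [(1, ![0, 0, -1, 0, 0, 0, 0, 0, 0]), (1, ![0, 0, 0, 0, 0, 0, 1, 0, 1]),
        (9, ![0, 0, 0, 0, 0, 0, 1, 0, 0])]),
    (![0, 0, 1, 0, 0, 1, 0, 0, 0],
      [(1, ![-1, -1, -1, -1, -1, -1, 0, -1, 0]), (4, ![-1, -1, -1, -1, -1, -1, 0, -1, -1]),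
        (4, ![-1, -1, -1, -1, -1, -1, -1, -1, -1])]),
    (![0, 0, 0, 0, 0, 0, 1, 0, 0],
      [(1, ![-1, -1, -1, -1, -1, 0, -1, -1, 0]), (4, ![0, 0, 0, 0, 0, 1, 0, 0, 1]),
        (4, ![0, 0, 0, 0, 0, 1, 0, 0, 0])]),
    (![0, 0, 0, 0, 1, 0, 1, 0, 0],
      [(2, ![-1, 0, -1, -1, -1, 0, -1, 0, 0]), (15, ![0, 0, 0, 0, 0, 1, 0, 1, 0])]),
    (![0, 0, 0, 0, 0, 0, 0, 1, 0],
      [(1, ![1, 1, 1, 1, 1, 1, 1, 1, 1]), (1, ![0, 1, 0, 0, 0, 0, 1, 0, 0]),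
        (9, ![0, 1, 0, 0, 0, 0, 0, 0, 0])]),
    (![0, 0, 1, 0, 0, 0, 0, 1, 0],
      [(1, ![-1, 0, 0, -1, -1, -1, -1, -1, -1]), (4, ![-1, 0, -1, -1, -1, -1, -1, -1, -1]),
        (4, ![0, 1, 0, 0, 0, 0, 0, 0, 0])]),
    (![0, 0, 1, 1, 0, 0, 0, 1, 0],
      [(2, ![-1, 0, 0, 0, -1, -1, 0, -1, -1]), (15, ![0, 1, 0, 1, 0, 0, 0, 0, 0])]),
    (![0, 0, 0, 0, 0, 1, 0, -1, 1],
      [(13, ![0, -1, 0, 0, 0, 0, 0, 0, 0]), (3, ![-1, -1, 0, -1, -1, -1, 0, -1, -1]),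
        (7, ![0, 0, 1, 0, 0, 0, 1, 0, 0])]),
    (![0, 0, 0, 0, 0, 0, 0, 0, 1],
      [(1, ![0, 0, 0, 0, 0, 0, 0, 0, -1]), (1, ![0, 1, 1, 0, 0, 0, 0, 0, 0]),
        (9, ![0, 0, 1, 0, 0, 0, 0, 0, 0])]),
    (![0, 0, 0, 0, 0, 1, 0, 0, 1],
      [(1, ![0, 1, 1, 0, 0, 0, 1, 0, 0]), (4, ![0, 0, 1, 0, 0, 0, 1, 0, 0]),
        (4, ![0, 0, 0, 0, 0, 0, 1, 0, 0])]),
    (![0, 0, 0, 0, 0, 0, 1, 0, 1],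
      [(2, ![-1, 0, 0, -1, -1, 0, -1, -1, 0]), (15, ![0, 0, 1, 0, 0, 1, 0, 0, 0])]),
    (![0, 1, 1, 1, 1, 1, 1, 0, 1],
      [(4, ![-1, 0, 0, 0, 0, 0, 0, 0, 0]), (4, ![-1, 0, 0, 0, 0, 0, 0, 0, -1]),
        (1, ![-1, -1, 0, 0, 0, 0, 0, 0, -1])])]

end Data

/-! ### The three coloring schemes and the final theorem. -/

section Colorings

theorem scheme_five : IsSublatticeColoringScheme (matrixLattice (genA 5))
    (matrixLattice (genA 5 * matC5.map (fun z : ℤ => (z : ℝ)))) 5 140 ∧ chiEuclidean 5 ≤ 140 := by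
  -- The bound n(n + 1)(n + 2)/12 on R² is 35/2 for n = 5, and ρ = 4 · 35/2.
  refine isSublatticeColoringScheme_of_certificates (ρ := 70) (K := 2) (D := 2344045)
    (rows := rowsC5) (certs := certsC5) coordA_mul_genA (by norm_num) one_pos gram_genA ?_
    (by norm_num) (fun x hx => ?_) rfl (by norm_num) (fun k => ?_) (by decide +kernel)
    (by decide +kernel)
  · simp only [matC5, norm_det]
    rfl
  · have := norm_sq_le_of_mem_voronoiCell_genA hx
    norm_num at this ⊢
    linarith
  · simp [rowsC5, List.ofFn_succ, triangularForm, listDot, matC5, gramA, Matrix.mulVec, dotProduct,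
      Fin.sum_univ_succ, Fin.succ_ne_zero]
    ring

theorem scheme_seven : IsSublatticeColoringScheme (matrixLattice genE7)
    (matrixLattice (genE7 * matC7.map (fun z : ℤ => (z : ℝ)))) 7 1372 ∧ chiEuclidean 7 ≤ 1372 := by
  -- The Gram matrix is doubled here (s = 2), so ρ = 4 · 2 · 7/8.
  refine isSublatticeColoringScheme_of_certificates (ρ := 7) (K := 2) (D := 457470)
    (rows := rowsC7) (certs := certsC7) coordE7_mul_genE7 (by norm_num) two_pos
    two_smul_gram_genE7 ?_
    (by norm_num) (fun x hx => ?_) rfl (by norm_num) (fun k => ?_) (by decide +kernel)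
    (by decide +kernel)
  · simp only [matC7, norm_det]
    rfl
  · have := norm_sq_le_of_mem_voronoiCell_genE7 hx
    norm_num at this ⊢
    linarith
  · simp [rowsC7, List.ofFn_succ, triangularForm, listDot, matC7, gramE7, Matrix.mulVec, dotProduct,
      Fin.sum_univ_succ]
    ring

theorem scheme_nine : IsSublatticeColoringScheme (matrixLattice (genA 9))
    (matrixLattice (genA 9 * matC9.map (fun z : ℤ => (z : ℝ)))) 9 17253 ∧
      chiEuclidean 9 ≤ 17253 := by
  -- For n = 9 the bound on R² is 165/2, and ρ is four times it.
  refine isSublatticeColoringScheme_of_certificates (ρ := 330) (K := 2) (D := 1833188789867292)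
    (rows := rowsC9) (certs := certsC9) coordA_mul_genA (by norm_num) one_pos gram_genA ?_
    (by norm_num) (fun x hx => ?_) rfl (by norm_num) (fun k => ?_) (by decide +kernel)
    (by decide +kernel)
  · simp only [matC9, norm_det]
    rfl
  · have := norm_sq_le_of_mem_voronoiCell_genA hx
    norm_num at this ⊢
    linarith
  · simp [rowsC9, List.ofFn_succ, triangularForm, listDot, matC9, gramA, Matrix.mulVec, dotProduct,
      Fin.sum_univ_succ, Fin.succ_ne_zero]
    ring

end Colorings

theorem theorem1p1 :
    (chiEuclidean 5 ≤ 140 ∧ chiEuclidean 7 ≤ 1372 ∧ chiEuclidean 9 ≤ 17253) ∧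
    (matrixLattice (genA 5) = (6 : ℝ) • dualLattice (rootLatticeA 5) ∧
      IsSublatticeColoringScheme (matrixLattice (genA 5))
        (matrixLattice (genA 5 * matC5.map (fun z : ℤ => (z : ℝ)))) 5 140) ∧
    (matrixLattice genE7 = dualLattice rootLatticeE7 ∧
      IsSublatticeColoringScheme (matrixLattice genE7)
        (matrixLattice (genE7 * matC7.map (fun z : ℤ => (z : ℝ)))) 7 1372) ∧
    (matrixLattice (genA 9) = (10 : ℝ) • dualLattice (rootLatticeA 9) ∧
      IsSublatticeColoringScheme (matrixLattice (genA 9))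
        (matrixLattice (genA 9 * matC9.map (fun z : ℤ => (z : ℝ)))) 9 17253) := by
  have h5 : matrixLattice (genA 5) = (6 : ℝ) • dualLattice (rootLatticeA 5) := by
    rw [matrixLattice_genA_eq]
    norm_num
  have h9 : matrixLattice (genA 9) = (10 : ℝ) • dualLattice (rootLatticeA 9) := by
    rw [matrixLattice_genA_eq]
    norm_num
  exact ⟨⟨scheme_five.2, scheme_seven.2, scheme_nine.2⟩, ⟨h5, scheme_five.1⟩,
    ⟨matrixLattice_genE7_eq, scheme_seven.1⟩, ⟨h9, scheme_nine.1⟩⟩
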